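/- **Conventions.** Let $M,N$ be finite-dimensional real vector spaces with a perfect pairing $(u,v)\mapsto u\cdot v$. Let $T_N$ be $N$ written multiplicatively; for $t\in T_N$ corresponding to $v\in N$ and for $u\in M$ put $t^u:=\exp(-u\cdot v)$. For a polyhedral (finitely generated) cone $\sigma\subset N$ with dual cone $\sigma^\vee=\{u\in M\mid u\cdot v\ge 0\ \forall v\in\sigma\}$, let $V_\sigma=\mathrm{Hom}_c(\sigma^\vee,\mathbb R_\ge)$ be the set of monoid homomorphisms from $(\sigma^\vee,+)$ to $(\mathbb R_\ge,\cdot)$ that are continuous on the relative interior of each face of $\sigma^\vee$, with the topology of pointwise convergence and the $T_N$-action $(t.\varphi)(u)=t^u\varphi(u)$. For a fan $\Sigma$ in $N$, let $Y_\Sigma$ be the space with $T_N$-action obtained from the disjoint union of the $V_\sigma$, $\sigma\in\Sigma$, by gluing along the restriction maps $V_\tau\hookrightarrow V_\sigma$ for faces $\tau$ of $\sigma$. For a finite set $\mathcal A\subset M$, let $\Delta^{\mathcal A}=\{z\in\mathbb R^{\mathcal A}_\ge\mid\sum_a z_a=1\}$, on which $\mathbb R^{\mathcal A}_>$ acts by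 scaling coordinates and then rescaling to coordinate sum $1$. Let $\varphi_{\mathcal A}\colon T_N\to\mathbb R^{\mathcal A}_>$ be the homomorphism $t\mapsto(t^a\mid a\in\mathcal A)$, let $Y_{\mathcal A}$ be the closure of its image in $\mathbb R^{\mathcal A}_\ge$, let $Z_{\mathcal A}=Y_{\mathcal A}\cap\Delta^{\mathcal A}$, and let $\pi_{\mathcal A}(z)=\sum_{a\in\mathcal A}z_a\,a$ be the algebraic moment map. **Theorem.** Let $P\subset M$ be a nonempty polytope (the convex hull of a finite set) lying on an affine hyperplane not through the origin: there are $v\in N$ and $r\ne 0$ with $x\cdot v=r$ for all $x\in P$. Let $\Sigma$ be its inner normal fan, whose cones are $$\sigma_F=\{v\in N\mid \text{the face of $P$ on which } u\mapsto u\cdot v \text{ is minimal contains } F\}$$ for the faces $F$ of $P$. Let $\mathcal A\subset P$ be a finite set with $\mathrm{conv}(\mathcal A)=P$. Then there is a continuous injective map $\Psi_{\mathcal A}\colon Y_\Sigma\to\Delta^{\mathcal A}$, equivariant in the sense that $\Psi_{\mathcal A}(t.y)=\varphi_{\mathcal A}(t).\Psi_{\mathcal A}(y)$ for all $t\in T_N$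 and $y\in Y_\Sigma$, whose image is $Z_{\mathcal A}$, and such that $\pi_{\mathcal A}\circ\Psi_{\mathcal A}$ is a homeomorphism $Y_\Sigma\xrightarrow{\sim}P$. -/

import Mathlib

open scoped NNReal

noncomputable section

namespace IrrToric

/-! ### Polyhedral cones, faces and fans -/

section Cones

variable {E : Type*} [AddCommGroup E] [Module ℝ E]

/-- `τ` is a face of the cone `σ`: it is the zero locus in `σ` of a linear functional that is
nonnegative on `σ`. -/
def IsFace (τ σ : PointedCone ℝ E) : Prop :=
  ∃ l : Module.Dual ℝ E, (∀ x ∈ σ, 0 ≤ l x) ∧ ∀ x, x ∈ τ ↔ x ∈ σ ∧ l x = 0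

/-- The relative interior of a polyhedral cone: the complement in it of its proper faces. -/
def relInt (σ : PointedCone ℝ E) : Set E :=
  {x | x ∈ σ ∧ ∀ τ : PointedCone ℝ E, IsFace τ σ → x ∈ τ → τ = σ}

/-- A fan: a finite collection of polyhedral (that is, finitely generated) cones containing every
face of each of its cones, in which any two cones meet in a common face. -/
structure Fan (E : Type*) [AddCommGroup E] [Module ℝ E] where
  cones : Set (PointedCone ℝ E)
  finite : cones.Finite
  polyhedral : ∀ σ ∈ cones, σ.FG
  face_mem : ∀ σ ∈ cones, ∀ τ, IsFace τ σ → τ ∈ cones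
  inter_isFace : ∀ σ ∈ cones, ∀ τ ∈ cones, IsFace (σ ⊓ τ) σ ∧ IsFace (σ ⊓ τ) τ

/-- `Hom_c(C, ℝ≥0)`: monoid homomorphisms from the additive monoid `C` to the multiplicative monoid
`ℝ≥0` that are continuous on the relative interior of each face of `C`. As a subtype of a function
space it carries the weakest topology for which all evaluations are continuous. -/
abbrev HomC [TopologicalSpace E] (C : PointedCone ℝ E) : Type _ :=
  {φ : C → ℝ≥0 // φ 0 = 1 ∧ (∀ x y, φ (x + y) = φ x * φ y) ∧
    ∀ F : PointedCone ℝ E, IsFace F C → ContinuousOn φ {x : C | (x : E) ∈ relInt F}}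

end Cones

/-! ### The irrational toric variety of a fan -/

section Varieties

variable {M N : Type*} [AddCommGroup M] [Module ℝ M] [TopologicalSpace M]
  [AddCommGroup N] [Module ℝ N]

/-- The dual cone `σ^∨ ⊆ M` of a cone `σ ⊆ N`. -/
abbrev dualCone (p : M →ₗ[ℝ] N →ₗ[ℝ] ℝ) (σ : PointedCone ℝ N) : PointedCone ℝ M :=
  PointedCone.dual p.flip (σ : Set N)

/-- The affine irrational toric variety `V_σ = Hom_c(σ^∨, ℝ≥0)`. -/
def V (p : M →ₗ[ℝ] N →ₗ[ℝ] ℝ) (σ : PointedCone ℝ N) : Type _ := HomC (dualCone p σ)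

instance (p : M →ₗ[ℝ] N →ₗ[ℝ] ℝ) (σ : PointedCone ℝ N) : TopologicalSpace (V p σ) :=
  inferInstanceAs (TopologicalSpace (HomC (dualCone p σ)))

/-- The torus `T_N` is `N` written multiplicatively; the element given by `v ∈ N` has the value
`t^u = exp (-u·v)` at the character `u ∈ M`. -/
def char (p : M →ₗ[ℝ] N →ₗ[ℝ] ℝ) (t : Multiplicative N) (u : M) : ℝ :=
  Real.exp (-(p u t.toAdd))

/-- The function `t.φ` on `σ^∨` for `t ∈ T_N` and `φ ∈ V_σ`: `(t.φ)(u) = t^u φ(u)`. -/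
def translate (p : M →ₗ[ℝ] N →ₗ[ℝ] ℝ) (σ : PointedCone ℝ N) (t : Multiplicative N) (φ : V p σ)
    (u : dualCone p σ) : ℝ≥0 :=
  ⟨char p t u, Real.exp_nonneg (-(p (u : M) t.toAdd))⟩ * φ.1 u

lemma coe_translate (p : M →ₗ[ℝ] N →ₗ[ℝ] ℝ) (σ : PointedCone ℝ N) (t : Multiplicative N)
    (φ : V p σ) (u : dualCone p σ) :
    (translate p σ t φ u : ℝ) = Real.exp (-(p (u : M) t.toAdd)) * (φ.1 u : ℝ) := rfl

variable [IsTopologicalAddGroup M] [ContinuousSMul ℝ M] [T2Space M] [FiniteDimensional ℝ M]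

/-- The action of `T_N` on `V_σ`: `(t.φ)(u) = t^u φ(u)`. -/
instance (p : M →ₗ[ℝ] N →ₗ[ℝ] ℝ) (σ : PointedCone ℝ N) :
    MulAction (Multiplicative N) (V p σ) where
  smul t φ := ⟨translate p σ t φ, by
    refine ⟨?_, fun x y => ?_, fun F hF => ?_⟩
    · ext; rw [coe_translate, φ.2.1]; simp
    · ext
      rw [NNReal.coe_mul, coe_translate, coe_translate, coe_translate, φ.2.2.1, NNReal.coe_mul,
        Submodule.coe_add, map_add, LinearMap.add_apply, neg_add, Real.exp_add]
      ring
    · refine ContinuousOn.mul (Continuous.continuousOn ?_) (φ.2.2.2 F hF)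
      have h : Continuous (p.flip t.toAdd) := LinearMap.continuous_of_finiteDimensional _
      exact Continuous.subtype_mk
        (Real.continuous_exp.comp (h.comp continuous_subtype_val).neg) _⟩
  one_smul φ := by
    apply Subtype.ext; funext u; ext
    change Real.exp (-(p (u : M) (1 : Multiplicative N).toAdd)) * (φ.1 u : ℝ) = φ.1 u
    simp
  mul_smul s t φ := by
    apply Subtype.ext; funext u; ext
    change Real.exp (-(p (u : M) (s * t).toAdd)) * (φ.1 u : ℝ) =
      Real.exp (-(p (u : M) s.toAdd)) * (Real.exp (-(p (u : M) t.toAdd)) * (φ.1 u : ℝ))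
    rw [toAdd_mul, map_add, neg_add, Real.exp_add]; ring

/-- The gluing relation on the disjoint union of the `V_σ`: for `τ` a face of `σ` (so that
`σ^∨ ⊆ τ^∨`), a point `φ` of `V_τ` is identified with its restriction to `σ^∨` in `V_σ`. -/
def Glue (p : M →ₗ[ℝ] N →ₗ[ℝ] ℝ) (S : Fan N) (x y : Σ σ : S.cones, V p (σ : PointedCone ℝ N)) :
    Prop :=
  IsFace (x.1 : PointedCone ℝ N) y.1 ∧
    ∀ (u : M) (hx : u ∈ dualCone p x.1) (hy : u ∈ dualCone p y.1), y.2.1 ⟨u, hy⟩ = x.2.1 ⟨u, hx⟩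

/-- The irrational toric variety `Y_Σ` of a fan `Σ`: the disjoint union of the `V_σ`, `σ ∈ Σ`, glued
along the inclusions `V_τ → V_σ` for faces `τ` of `σ` (the quotient by the equivalence relation
generated by `Glue`, with the quotient topology). -/
def ITV (p : M →ₗ[ℝ] N →ₗ[ℝ] ℝ) (S : Fan N) : Type _ := Quot (Glue p S)

instance (p : M →ₗ[ℝ] N →ₗ[ℝ] ℝ) (S : Fan N) : TopologicalSpace (ITV p S) :=
  inferInstanceAs (TopologicalSpace (Quot (Glue p S)))

/-- The action of `T_N` on `Y_Σ` induced by the actions on the `V_σ`. -/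
instance (p : M →ₗ[ℝ] N →ₗ[ℝ] ℝ) (S : Fan N) : MulAction (Multiplicative N) (ITV p S) where
  smul t := Quot.map (fun x => ⟨x.1, t • x.2⟩) (by
    rintro ⟨σ, φ⟩ ⟨τ, ψ⟩ ⟨h, hr⟩
    refine ⟨h, fun u hx hy => ?_⟩
    change _ * ψ.1 ⟨u, hy⟩ = _ * φ.1 ⟨u, hx⟩
    rw [hr u hx hy])
  one_smul := by
    rintro ⟨σ, φ⟩
    exact congrArg (fun ψ => Quot.mk (Glue p S) ⟨σ, ψ⟩) (one_smul _ φ)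
  mul_smul s t := by
    rintro ⟨σ, φ⟩
    exact congrArg (fun ψ => Quot.mk (Glue p S) ⟨σ, ψ⟩) (mul_smul s t φ)

end Varieties

/-! ### The simplex and projective irrational toric varieties -/

/-- The positive real numbers, a multiplicative group. -/
abbrev RPos : Type := {x : ℝ // 0 < x}

section Simplex

variable {ι : Type*} [Fintype ι]

lemma sum_smul_pos (w : ι → RPos) (z : stdSimplex ℝ ι) : 0 < ∑ i, (w i : ℝ) * z.1 i := by
  have h0 : ∀ i ∈ Finset.univ, 0 ≤ (w i : ℝ) * z.1 i := fun i _ => mul_nonneg (w i).2.le (z.2.1 i)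
  refine lt_of_le_of_ne (Finset.sum_nonneg h0) fun h => ?_
  rw [eq_comm, Finset.sum_eq_zero_iff_of_nonneg h0] at h
  have h1 : ∀ i ∈ Finset.univ, z.1 i = 0 := fun i hi =>
    (mul_eq_zero.1 (h i hi)).resolve_left (w i).2.ne'
  have h2 := z.2.2
  rw [Finset.sum_eq_zero h1] at h2
  exact zero_ne_one h2

/-- The action of the torus `ℝ_>^ι` on the simplex: scale the coordinates, then return along the
ray through the origin to the simplex. -/
instance : MulAction (ι → RPos) (stdSimplex ℝ ι) where
  smul w z := ⟨fun i => (w i : ℝ) * z.1 i / ∑ j, (w j : ℝ) * z.1 j,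
    fun i => div_nonneg (mul_nonneg (w i).2.le (z.2.1 i)) (sum_smul_pos w z).le, by
      rw [← Finset.sum_div, div_self (sum_smul_pos w z).ne']⟩
  one_smul z := by
    apply Subtype.ext; funext i
    change ((1 : RPos) : ℝ) * z.1 i / ∑ j, ((1 : RPos) : ℝ) * z.1 j = z.1 i
    simp [z.2.2]
  mul_smul w w' z := by
    apply Subtype.ext; funext i
    change ((w i * w' i : RPos) : ℝ) * z.1 i / ∑ j, ((w j * w' j : RPos) : ℝ) * z.1 j =
      (w i : ℝ) * ((w' i : ℝ) * z.1 i / ∑ k, (w' k : ℝ) * z.1 k) /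
        ∑ j, (w j : ℝ) * ((w' j : ℝ) * z.1 j / ∑ k, (w' k : ℝ) * z.1 k)
    have h := (sum_smul_pos w' z).ne'
    simp only [Positive.val_mul, mul_div_assoc', ← Finset.sum_div]
    rw [div_div_div_cancel_right₀ h]
    simp only [mul_assoc]

end Simplex

section Projective

variable {M N : Type*} [AddCommGroup M] [Module ℝ M]
  [AddCommGroup N] [Module ℝ N] [TopologicalSpace N]
  [IsTopologicalAddGroup N] [ContinuousSMul ℝ N] [T2Space N] [FiniteDimensional ℝ N]

/-- The homomorphism `φ_A : T_N → ℝ_>^A`, `t ↦ (t^a | a ∈ A)`, of topological groups. -/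
def torusHom (p : M →ₗ[ℝ] N →ₗ[ℝ] ℝ) (A : Finset M) : Multiplicative N →ₜ* (A → RPos) where
  toFun t a := ⟨char p t a, Real.exp_pos _⟩
  map_one' := by funext a; apply Subtype.ext; simp [char]
  map_mul' s t := by
    funext a; apply Subtype.ext
    simp [char, Real.exp_add, mul_comm]
  continuous_toFun := by
    refine continuous_pi fun a => Continuous.subtype_mk ?_ _
    have h : Continuous (p a) := LinearMap.continuous_of_finiteDimensional _
    exact Real.continuous_exp.comp (h.comp continuous_toAdd).neg

/-- The affine irrational toric variety `Y_A`: the closure of the image of `φ_A` (the orthant is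
closed, so the closure may be taken in `ℝ^A`). -/
def affineITV (p : M →ₗ[ℝ] N →ₗ[ℝ] ℝ) (A : Finset M) : Set (A → ℝ) :=
  closure (Set.range fun (t : Multiplicative N) (a : A) => (torusHom p A t a : ℝ))

/-- The projective irrational toric variety `Z_A`: the intersection of `Y_A` with the simplex. -/
def projITV (p : M →ₗ[ℝ] N →ₗ[ℝ] ℝ) (A : Finset M) : Set (stdSimplex ℝ A) :=
  {z | (z : A → ℝ) ∈ affineITV p A}

/-- The algebraic moment map `π_A(z) = ∑ z_a a`. -/
def momentMap (A : Finset M) (z : stdSimplex ℝ A) : M := ∑ a : A, (z : A → ℝ) a • (a : M)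

end Projective

/-! ### Polytopes and their normal fans -/

section Polytopes

variable {M N : Type*} [AddCommGroup M] [Module ℝ M] [AddCommGroup N] [Module ℝ N]

/-- A polytope is the convex hull of a finite set. -/
def IsPolytope (P : Set M) : Prop := ∃ S : Finset M, convexHull ℝ (S : Set M) = P

/-- The face of `P` exposed by `v`: the subset where `u ↦ u·v` is minimized on `P`. -/
def exposedFace (p : M →ₗ[ℝ] N →ₗ[ℝ] ℝ) (P : Set M) (v : N) : Set M :=
  {x | x ∈ P ∧ ∀ y ∈ P, p x v ≤ p y v}

/-- For a face `F` of `P`, the cone `σ_F` of those `v` that expose a face containing `F`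
(see `mem_normalCone_iff`). -/
def normalCone (p : M →ₗ[ℝ] N →ₗ[ℝ] ℝ) (P F : Set M) : PointedCone ℝ N where
  carrier := {v | ∀ x ∈ F, ∀ y ∈ P, p x v ≤ p y v}
  add_mem' := by
    intro v w hv hw x hx y hy
    simpa using add_le_add (hv x hx y hy) (hw x hx y hy)
  zero_mem' := by intro _ _ _ _; simp
  smul_mem' := by
    intro c v hv x hx y hy
    change p x ((c : ℝ) • v) ≤ p y ((c : ℝ) • v)
    rw [map_smul, map_smul]
    exact mul_le_mul_of_nonneg_left (hv x hx y hy) c.2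

lemma mem_normalCone_iff (p : M →ₗ[ℝ] N →ₗ[ℝ] ℝ) {P F : Set M} (hF : F ⊆ P) (v : N) :
    v ∈ normalCone p P F ↔ F ⊆ exposedFace p P v :=
  ⟨fun h x hx => ⟨hF hx, h x hx⟩, fun h _ hx => (h hx).2⟩

/-- The cones `σ_F`, for `F` a face of `P`. -/
def normalCones (p : M →ₗ[ℝ] N →ₗ[ℝ] ℝ) (P : Set M) : Set (PointedCone ℝ N) :=
  {σ | ∃ v : N, σ = normalCone p P (exposedFace p P v)}

/-! The remaining lemmas check the axioms of a fan for the normal cones of a polytope. -/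

lemma fg_inf_halfspace (C : PointedCone ℝ N) (hC : C.FG) (l : Module.Dual ℝ N)
    (D : PointedCone ℝ N) (hD : ∀ x, x ∈ D ↔ x ∈ C ∧ 0 ≤ l x) : D.FG := by
  classical
  obtain ⟨S, rfl⟩ := hC
  let S₁ := S.filter fun s => 0 ≤ l s
  let S₂ := S.filter fun s => l s < 0
  let T : Finset N := S₁ ∪ Finset.image₂ (fun s t => l s • t - l t • s) S₁ S₂
  have hS : S = S₁ ∪ S₂ := by
    ext s; simp only [S₁, S₂, Finset.mem_union, Finset.mem_filter]
    rcases le_or_gt 0 (l s) with h | h <;> simp [h, not_lt.2, not_le.2]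
  let H (U : Finset N) : PointedCone ℝ N := PointedCone.hull ℝ (U : Set N)
  have smul_mem' : ∀ (K : PointedCone ℝ N) (c : ℝ) (x : N), 0 ≤ c → x ∈ K → c • x ∈ K :=
    fun K c x hc hx => K.smul_mem hc hx
  have pos : ∀ w ∈ H S₁, 0 ≤ l w := by
    intro w hw
    induction hw using Submodule.span_induction with
    | mem x hx => exact (Finset.mem_filter.1 hx).2
    | zero => simp
    | add x y _ _ hx hy => simpa using add_nonneg hx hy
    | smul c x _ hx =>
      change 0 ≤ l ((c : ℝ) • x)
      rw [map_smul]
      exact mul_nonneg c.2 hx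
  have neg : ∀ z ∈ H S₂, z = 0 ∨ l z < 0 := by
    intro z hz
    induction hz using Submodule.span_induction with
    | mem x hx => exact Or.inr (Finset.mem_filter.1 hx).2
    | zero => simp
    | add x y _ _ hx hy =>
      rcases hx with rfl | hx
      · simpa using hy
      · rcases hy with rfl | hy
        · simpa using Or.inr hx
        · right; simpa using add_neg hx hy
    | smul c x _ hx =>
      rcases hx with rfl | hx
      · simp
      · rcases eq_or_lt_of_le c.2 with hc | hc
        · left
          change (c : ℝ) • x = 0
          rw [← hc]; simp
        · right
          change l ((c : ℝ) • x) < 0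
          rw [map_smul]
          exact mul_neg_of_pos_of_neg hc hx
  have cross : ∀ w ∈ H S₁, ∀ z ∈ H S₂, l w • z - l z • w ∈ H T := by
    intro w hw
    induction hw using Submodule.span_induction with
    | mem s hs =>
      intro z hz
      induction hz using Submodule.span_induction with
      | mem t ht =>
        apply Submodule.subset_span
        exact Finset.mem_coe.2 (Finset.mem_union_right _ (Finset.mem_image₂_of_mem hs ht))
      | zero => simp
      | add x y _ _ hx hy =>
        convert (H T).add_mem hx hy using 1
        simp only [map_add, smul_add, add_smul]; abel
      | smul c x _ hx =>
        convert smul_mem' (H T) c _ c.2 hx using 1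
        change l s • ((c : ℝ) • x) - l ((c : ℝ) • x) • s = _
        simp only [map_smul, smul_eq_mul]; module
    | zero => intro z _; simp
    | add x y _ _ hx hy =>
      intro z hz
      convert (H T).add_mem (hx z hz) (hy z hz) using 1
      simp only [map_add, smul_add, add_smul]; abel
    | smul c x _ hx =>
      intro z hz
      convert smul_mem' (H T) c _ c.2 (hx z hz) using 1
      change l ((c : ℝ) • x) • z - l z • ((c : ℝ) • x) = _
      simp only [map_smul, smul_eq_mul]; module
  have hsub : H S₁ ≤ H T := Submodule.span_mono (by
    intro x hx; exact Finset.mem_coe.2 (Finset.mem_union_left _ hx))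
  refine ⟨T, le_antisymm (Submodule.span_le.2 ?_) ?_⟩
  · intro x hx
    rcases Finset.mem_union.1 (Finset.mem_coe.1 hx) with h | h
    · obtain ⟨h1, h2⟩ := Finset.mem_filter.1 h
      exact (hD x).2 ⟨Submodule.subset_span h1, h2⟩
    · obtain ⟨s, hs, t, ht, rfl⟩ := Finset.mem_image₂.1 h
      obtain ⟨h1, h2⟩ := Finset.mem_filter.1 hs
      obtain ⟨h3, h4⟩ := Finset.mem_filter.1 ht
      refine (hD _).2 ⟨?_, ?_⟩
      · rw [sub_eq_add_neg, ← neg_smul]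
        exact Submodule.add_mem _ (smul_mem' _ _ _ h2 (Submodule.subset_span h3))
          (smul_mem' _ _ _ (by linarith) (Submodule.subset_span h1))
      · simp [mul_comm]
  · intro x hx
    obtain ⟨hx, hlx⟩ := (hD x).1 hx
    rw [hS, Finset.coe_union, Submodule.span_union] at hx
    obtain ⟨w, hw, z, hz, rfl⟩ := Submodule.mem_sup.1 hx
    rcases neg z hz with rfl | hlz
    · simpa using hsub hw
    · rw [map_add] at hlx
      have hlw : 0 < l w := by linarith
      have : w + z = ((l w + l z) / l w) • w + (1 / l w) • (l w • z - l z • w) := by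
        rw [smul_sub, smul_smul, smul_smul, one_div_mul_cancel hlw.ne', one_smul, add_div,
          div_self hlw.ne']
        module
      rw [this]
      exact (H T).add_mem (smul_mem' _ _ _ (div_nonneg hlx hlw.le) (hsub hw))
        (smul_mem' _ _ _ (by positivity) (cross w hw z hz))

lemma fg_top [FiniteDimensional ℝ N] : (⊤ : PointedCone ℝ N).FG := by
  classical
  let b := Module.finBasis ℝ N
  refine ⟨Finset.univ.image b ∪ Finset.univ.image fun i => -b i, ?_⟩
  rw [eq_top_iff]
  intro x _
  rw [← b.sum_repr x]
  refine Submodule.sum_mem _ fun i _ => ?_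
  rcases le_total 0 (b.repr x i) with h | h
  · exact PointedCone.smul_mem _ h (Submodule.subset_span (by simp))
  · rw [← neg_smul_neg]
    exact PointedCone.smul_mem _ (neg_nonneg.2 h) (Submodule.subset_span (by simp))

lemma fg_dual [FiniteDimensional ℝ N] (p : M →ₗ[ℝ] N →ₗ[ℝ] ℝ) (S : Finset M) :
    (PointedCone.dual p (S : Set M)).FG := by
  classical
  induction S using Finset.induction_on with
  | empty => simpa using fg_top
  | insert a S _ ih =>
    refine fg_inf_halfspace _ ih (p a) _ fun x => ?_
    rw [Finset.coe_insert, PointedCone.dual_insert, Submodule.mem_inf, and_comm]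
    simp

/-- The elements of a finite set `S` at which `u ↦ u·v` is minimal on `S`. -/
def minimizers (p : M →ₗ[ℝ] N →ₗ[ℝ] ℝ) (S : Finset M) (v : N) : Set M :=
  {s | s ∈ S ∧ ∀ a ∈ S, p s v ≤ p a v}

lemma le_on_hull (p : M →ₗ[ℝ] N →ₗ[ℝ] ℝ) (S : Finset M) (v : N) (c : ℝ)
    (h : ∀ a ∈ S, c ≤ p a v) : ∀ y ∈ convexHull ℝ (S : Set M), c ≤ p y v :=
  fun _ hy => convexHull_min (t := {y | c ≤ p y v}) h
    (convex_halfSpace_ge (p.flip v).isLinear c) hy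

lemma mem_normalCone_minimizers (p : M →ₗ[ℝ] N →ₗ[ℝ] ℝ) (S : Finset M) (hS : S.Nonempty)
    (v w : N) :
    w ∈ normalCone p (convexHull ℝ (S : Set M)) (exposedFace p (convexHull ℝ (S : Set M)) v) ↔
      minimizers p S v ⊆ minimizers p S w := by
  constructor
  · intro h s hs
    refine ⟨hs.1, fun a ha => h s ⟨subset_convexHull ℝ _ hs.1, ?_⟩ a (subset_convexHull ℝ _ ha)⟩
    exact le_on_hull p S v _ hs.2
  · intro h x hx y hy
    obtain ⟨s₀, hs₀, hmin⟩ := S.exists_min_image (fun s => p s v) hS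
    have hw := h ⟨hs₀, hmin⟩
    refine le_trans ?_ (le_on_hull p S w _ hw.2 y hy)
    obtain ⟨c, hc0, hc1, rfl⟩ := (Finset.mem_convexHull' (R := ℝ)).1 hx.1
    have hv := hx.2 s₀ (subset_convexHull ℝ _ hs₀)
    have hex : ∀ u : N, p (∑ a ∈ S, c a • a) u = ∑ a ∈ S, c a * p a u := by
      intro u; simp [map_sum, LinearMap.sum_apply]
    rw [hex] at hv ⊢
    have key : ∀ a ∈ S, c a * (p a v - p s₀ v) = 0 := by
      refine (Finset.sum_eq_zero_iff_of_nonneg fun a ha =>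
        mul_nonneg (hc0 a ha) (sub_nonneg.2 (hmin a ha))).1 (le_antisymm ?_
          (Finset.sum_nonneg fun a ha => mul_nonneg (hc0 a ha) (sub_nonneg.2 (hmin a ha))))
      simp only [mul_sub, Finset.sum_sub_distrib, ← Finset.sum_mul, hc1, one_mul]
      linarith
    have : ∀ a ∈ S, c a * p a w ≤ c a * p s₀ w := by
      intro a ha
      rcases mul_eq_zero.1 (key a ha) with h0 | h0
      · simp [h0]
      · have : a ∈ minimizers p S v := ⟨ha, fun b hb => by
          have := hmin b hb
          linarith⟩
        exact mul_le_mul_of_nonneg_left ((h this).2 s₀ hs₀) (hc0 a ha)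
    calc ∑ a ∈ S, c a * p a w ≤ ∑ a ∈ S, c a * p s₀ w := Finset.sum_le_sum this
      _ = p s₀ w := by rw [← Finset.sum_mul, hc1, one_mul]

lemma normalCones_finite (p : M →ₗ[ℝ] N →ₗ[ℝ] ℝ) (S : Finset M) (hS : S.Nonempty) :
    (normalCones p (convexHull ℝ (S : Set M))).Finite := by
  have : (normalCones p (convexHull ℝ (S : Set M))) =
      Set.range fun v => normalCone p (convexHull ℝ (S : Set M))
        (exposedFace p (convexHull ℝ (S : Set M)) v) := by
    ext σ; simp [normalCones, eq_comm]
  rw [this]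
  have hfin : (Set.range (minimizers p S)).Finite :=
    (S.finite_toSet.finite_subsets).subset (by rintro _ ⟨v, rfl⟩ s hs; exact hs.1)
  refine Set.Finite.of_finite_image (f := fun σ : PointedCone ℝ N => (σ : Set N)) ?_
    SetLike.coe_injective.injOn
  refine (hfin.image fun Q => {w | Q ⊆ minimizers p S w}).subset ?_
  rintro _ ⟨_, ⟨v, rfl⟩, rfl⟩
  exact ⟨_, ⟨v, rfl⟩, by ext w; exact (mem_normalCone_minimizers p S hS v w).symm⟩

lemma normalCones_fg [FiniteDimensional ℝ N] (p : M →ₗ[ℝ] N →ₗ[ℝ] ℝ) (S : Finset M)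
    (hS : S.Nonempty) (v : N) :
    (normalCone p (convexHull ℝ (S : Set M))
      (exposedFace p (convexHull ℝ (S : Set M)) v)).FG := by
  classical
  have := fg_dual p (Finset.image₂ (fun a s => a - s) S (S.filter (· ∈ minimizers p S v)))
  convert this using 1
  ext w
  rw [mem_normalCone_minimizers p S hS, PointedCone.mem_dual]
  constructor
  · intro h x hx
    obtain ⟨a, ha, s, hs, rfl⟩ := Finset.mem_image₂.1 (Finset.mem_coe.1 hx)
    simpa using (h (Finset.mem_filter.1 hs).2).2 a ha
  · intro h s hs
    refine ⟨hs.1, fun a ha => ?_⟩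
    have := @h (a - s) (Finset.mem_coe.2
      (Finset.mem_image₂_of_mem ha (Finset.mem_filter.2 ⟨hs.1, hs⟩)))
    simpa using this

lemma normalCones_face (p : M →ₗ[ℝ] N →ₗ[ℝ] ℝ) (S : Finset M) (hS : S.Nonempty)
    (σ : PointedCone ℝ N) (hσ : σ ∈ normalCones p (convexHull ℝ (S : Set M)))
    (τ : PointedCone ℝ N) (hτ : IsFace τ σ) : τ ∈ normalCones p (convexHull ℝ (S : Set M)) := by
  classical
  obtain ⟨v, rfl⟩ := hσ
  obtain ⟨l, hl0, hl⟩ := hτ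
  simp only [mem_normalCone_minimizers p S hS] at hl0 hl
  obtain ⟨s₀, hs₀, hmin⟩ := S.exists_min_image (fun s => p s v) hS
  have hs₀v : s₀ ∈ minimizers p S v := ⟨hs₀, hmin⟩
  have hτmin : ∀ w ∈ τ, ∀ a ∈ S, p s₀ w ≤ p a w := fun w hw =>
    (((hl w).1 hw).1 hs₀v).2
  have hex : ∀ a : M, ∃ w ∈ τ, (∃ w' ∈ τ, p s₀ w' < p a w') → p s₀ w < p a w := by
    intro a
    by_cases h : ∃ w' ∈ τ, p s₀ w' < p a w'
    · obtain ⟨w', h1, h2⟩ := h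
      exact ⟨w', h1, fun _ => h2⟩
    · exact ⟨0, τ.zero_mem, fun h' => absurd h' h⟩
  choose g hgτ hg using hex
  let v₀ := ∑ a ∈ S, g a
  have hv₀ : v₀ ∈ τ := Submodule.sum_mem _ fun a _ => hgτ a
  have hv₀' : minimizers p S v ⊆ minimizers p S v₀ := ((hl v₀).1 hv₀).1
  have hs₀' := hv₀' hs₀v
  have heq : ∀ a ∈ minimizers p S v₀, ∀ w ∈ τ, p a w = p s₀ w := by
    intro a ha w hw
    by_contra hne
    have hlt : p s₀ w < p a w := lt_of_le_of_ne (hτmin w hw a ha.1) (Ne.symm hne)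
    have h1 : p s₀ v₀ < p a v₀ := by
      simp only [v₀, map_sum]
      exact Finset.sum_lt_sum (fun b _ => hτmin _ (hgτ b) a ha.1)
        ⟨a, ha.1, hg a ⟨w, hw, hlt⟩⟩
    exact absurd (ha.2 s₀ hs₀) (not_le.2 h1)
  refine ⟨v₀, ?_⟩
  ext w
  rw [mem_normalCone_minimizers p S hS]
  constructor
  · intro hw a ha
    refine ⟨ha.1, fun b hb => ?_⟩
    rw [heq a ha w hw]
    exact hτmin w hw b hb
  · intro hw
    have hvw := hv₀'.trans hw
    refine (hl w).2 ⟨hvw, ?_⟩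
    have hws₀ := hw hs₀'
    -- a point slightly beyond `v₀` on the line from `w` stays in the cone
    have hε : ∃ ε : ℝ, 0 < ε ∧ ∀ a ∈ S, ε * (p a w - p s₀ w) ≤ (1 + ε) * (p a v₀ - p s₀ v₀) := by
      have hall : ∀ a ∈ S, ∀ᶠ ε in nhdsWithin (0 : ℝ) (Set.Ioi 0),
          ε * (p a w - p s₀ w) ≤ (1 + ε) * (p a v₀ - p s₀ v₀) := by
        intro a ha
        by_cases ham : a ∈ minimizers p S v₀
        · have h1 : p a v₀ = p s₀ v₀ := heq a ham v₀ hv₀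
          have h2 : p a w = p s₀ w := le_antisymm ((hw ham).2 s₀ hs₀) (hws₀.2 a ha)
          simp [h1, h2]
        · have h1 : p s₀ v₀ < p a v₀ := by
            by_contra hcon
            exact ham ⟨ha, fun b hb => (not_lt.1 hcon).trans (hs₀'.2 b hb)⟩
          have hc1 : Filter.Tendsto (fun ε : ℝ => ε * (p a w - p s₀ w)) (nhds 0) (nhds 0) := by
            have hcont : Continuous (fun ε : ℝ => ε * (p a w - p s₀ w)) := by fun_prop
            exact hcont.tendsto' _ _ (by simp)
          have hc2 : Filter.Tendsto (fun ε : ℝ => (1 + ε) * (p a v₀ - p s₀ v₀)) (nhds 0)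
              (nhds (p a v₀ - p s₀ v₀)) := by
            have hcont : Continuous (fun ε : ℝ => (1 + ε) * (p a v₀ - p s₀ v₀)) := by fun_prop
            exact hcont.tendsto' _ _ (by simp)
          have := hc1.eventually_lt hc2 (sub_pos.2 h1)
          exact (this.filter_mono nhdsWithin_le_nhds).mono fun ε h => h.le
      have := (S.eventually_all.2 hall).and self_mem_nhdsWithin
      obtain ⟨ε, h1, h2⟩ := this.exists
      exact ⟨ε, h2, h1⟩
    obtain ⟨ε, hε0, hε⟩ := hε
    have hmem : minimizers p S v ⊆ minimizers p S ((1 + ε) • v₀ - ε • w) := by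
      intro s hs
      refine ⟨hs.1, fun a ha => ?_⟩
      have h1 := hε a ha
      have h2 : p s v₀ = p s₀ v₀ := heq s (hv₀' hs) v₀ hv₀
      have h3 : p s w = p s₀ w := le_antisymm ((hvw hs).2 s₀ hs₀) (hws₀.2 s hs.1)
      simp only [map_sub, map_smul, smul_eq_mul, h2, h3]
      linarith
    have h1 := hl0 _ hmem
    have h2 := hl0 w hvw
    have h3 := ((hl v₀).1 hv₀).2
    simp only [map_sub, map_smul, smul_eq_mul, h3] at h1
    nlinarith

lemma normalCones_inter (p : M →ₗ[ℝ] N →ₗ[ℝ] ℝ) (S : Finset M) (hS : S.Nonempty)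
    (σ : PointedCone ℝ N) (hσ : σ ∈ normalCones p (convexHull ℝ (S : Set M)))
    (τ : PointedCone ℝ N) (hτ : τ ∈ normalCones p (convexHull ℝ (S : Set M))) :
    IsFace (σ ⊓ τ) σ := by
  classical
  obtain ⟨v, rfl⟩ := hσ
  obtain ⟨w, rfl⟩ := hτ
  obtain ⟨s₀, hs₀, hmin⟩ := S.exists_min_image (fun s => p s v) hS
  have hs₀v : s₀ ∈ minimizers p S v := ⟨hs₀, hmin⟩
  let R := S.filter (· ∈ minimizers p S w)
  have hR : ∀ {s}, s ∈ R ↔ s ∈ minimizers p S w := by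
    intro s; exact ⟨fun h => (Finset.mem_filter.1 h).2, fun h => Finset.mem_filter.2 ⟨h.1, h⟩⟩
  have hl : ∀ x, p (∑ s ∈ R, (s - s₀)) x = ∑ s ∈ R, (p s x - p s₀ x) := by
    intro x; rw [map_sum, LinearMap.sum_apply]; simp
  have hterm : ∀ x, minimizers p S v ⊆ minimizers p S x → ∀ s ∈ R, 0 ≤ p s x - p s₀ x :=
    fun x hx s hs => sub_nonneg.2 ((hx hs₀v).2 s (hR.1 hs).1)
  refine ⟨p (∑ s ∈ R, (s - s₀)), fun x hx => ?_, fun x => ?_⟩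
  · rw [mem_normalCone_minimizers p S hS] at hx
    rw [hl]
    exact Finset.sum_nonneg (hterm x hx)
  · rw [Submodule.mem_inf, mem_normalCone_minimizers p S hS, mem_normalCone_minimizers p S hS]
    refine and_congr_right fun hx => ?_
    rw [hl, Finset.sum_eq_zero_iff_of_nonneg (hterm x hx)]
    constructor
    · intro h s hs
      exact sub_eq_zero.2 (le_antisymm ((h (hR.1 hs)).2 s₀ hs₀) ((hx hs₀v).2 s (hR.1 hs).1))
    · intro h s hs
      refine ⟨hs.1, fun a ha => ?_⟩
      rw [sub_eq_zero.1 (h s (hR.2 hs))]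
      exact (hx hs₀v).2 a ha

/-- The (inner) normal fan of a nonempty polytope `P`: its cones are the `σ_F`, `F` a face of
`P`. -/
def normalFan [FiniteDimensional ℝ N] (p : M →ₗ[ℝ] N →ₗ[ℝ] ℝ) (P : Set M) (hP : IsPolytope P)
    (hne : P.Nonempty) : Fan N where
  cones := normalCones p P
  finite := by
    obtain ⟨S, rfl⟩ := hP
    exact normalCones_finite p S (by simpa using hne)
  polyhedral := by
    obtain ⟨S, rfl⟩ := hP
    rintro _ ⟨v, rfl⟩
    exact normalCones_fg p S (by simpa using hne) v
  face_mem := by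
    obtain ⟨S, rfl⟩ := hP
    exact normalCones_face p S (by simpa using hne)
  inter_isFace := by
    obtain ⟨S, rfl⟩ := hP
    intro σ hσ τ hτ
    refine ⟨normalCones_inter p S (by simpa using hne) σ hσ τ hτ, ?_⟩
    rw [inf_comm]
    exact normalCones_inter p S (by simpa using hne) τ hτ σ hσ

/-- `P` lies on an affine hyperplane of `M` that avoids the origin. -/
def OnAffineHyperplane (p : M →ₗ[ℝ] N →ₗ[ℝ] ℝ) (P : Set M) : Prop :=
  ∃ (v : N) (r : ℝ), r ≠ 0 ∧ ∀ x ∈ P, p x v = r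

end Polytopes

end IrrToric

end

/-!
The projective toric variety `Z_A` is cut out in the simplex by binomial equations: `z ∈ Z_A` iff
`∏ z_a ^ c_a = ∏ z_a ^ d_a` whenever `c, d ≥ 0` are real exponents with `∑ c_a a = ∑ d_a a`
(`IsToric`, `mem_projITV_iff_isToric`). These equations survive limits of torus points. Conversely,
Farkas' lemma shows that the support of a solution `z` is `A ∩ v^⊥` for some `v` that is nonnegative
on `A`, and `log z` is linear on this support, so that `z_a = exp (-a·w)` there (`IsFaceExp`); such
a point is the limit of the torus elements `w + n v`.

On `V_σ` the map to the simplex has homogeneous coordinates `φ(a - s)`, with `s ∈ A` on the face of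
`P` dual to `σ` (`chart`). Continuity on relative interiors of faces makes `φ` homogeneous,
`φ(c u) = φ(u) ^ c` (`HomC.map_smul`). Hence the coordinates satisfy the binomial equations, which
are homogeneous because `A` lies on a hyperplane off the origin. As `σ^∨` is generated by the
differences `a - s`, they also determine `φ`, and continuously so (`chart_injective`,
`continuous_of_continuous_chart`). A point of `Z_A` with data `v, w` is the image of the explicit
element `facePoint` in the chart of the normal cone through `v`, and any other preimage is glued to
this one (`eq_faceClass`). So `Y_Σ → Z_A` is bijective, with an inverse that is continuous chart by
chart, and `Y_Σ` is compact because `Z_A` is (`compactSpace_itv`).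

It remains to see that the moment map is a bijection from `Z_A` to `P`. If two solutions `z, z'` of
the binomial equations have the same moment, then `∑ (z - z') (log z - log z') = 0`, whence `z = z'`
(`IsToric.eq_of_momentMap_eq`). Over a given point of `P`, the point of maximal entropy
in the fibre is a solution (`exists_isToric_momentMap_eq`). The resulting continuous bijection from
the compact space `Y_Σ` to the Hausdorff space `P` is a homeomorphism.
-/

namespace IrrToric

/-! ### Farkas' lemma -/

section Farkas

variable {E ι : Type*} [AddCommGroup E] [Module ℝ E]

/-- **Farkas' lemma** for a finite family: a vector outside the cone generated by the family is
separated from it by a linear functional. The induction on the family projects along the new vector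
to the kernel of a functional that separates the others. -/
theorem farkas (s : Finset ι) (f : ι → E) (u : E) :
    (∃ c : ι → ℝ, (∀ i, 0 ≤ c i) ∧ ∑ i ∈ s, c i • f i = u) ∨
      ∃ l : Module.Dual ℝ E, (∀ i ∈ s, 0 ≤ l (f i)) ∧ l u < 0 := by
  classical
  induction s using Finset.induction_on generalizing f u with
  | empty =>
    by_cases hu : u = 0
    · exact Or.inl ⟨0, fun _ => le_rfl, by simp [hu]⟩
    · have hex : ∃ l : Module.Dual ℝ E, l u ≠ 0 := by
        by_contra! h
        exact hu ((Module.forall_dual_apply_eq_zero_iff ℝ u).1 h)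
      obtain ⟨l, hl⟩ := hex
      rcases lt_or_gt_of_ne hl with h | h
      · exact Or.inr ⟨l, by simp, h⟩
      · exact Or.inr ⟨-l, by simp, by simpa using h⟩
  | insert a s has ih =>
    rcases ih f u with ⟨c, hc, rfl⟩ | ⟨l, hl, hlu⟩
    · refine Or.inl ⟨Function.update c a 0, fun i => ?_, ?_⟩
      · rcases eq_or_ne i a with rfl | h
        · simp
        · simpa [h] using hc i
      · rw [Finset.sum_insert has]
        simp only [Function.update_self, zero_smul, zero_add]
        exact Finset.sum_congr rfl fun i hi => by
          rw [Function.update_of_ne (ne_of_mem_of_not_mem hi has)]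
    by_cases hla : 0 ≤ l (f a)
    · exact Or.inr ⟨l, fun i hi => (Finset.mem_insert.1 hi).elim (fun h => h ▸ hla) (hl i), hlu⟩
    rw [not_le] at hla
    let q : E →ₗ[ℝ] E := LinearMap.id - (l.smulRight ((l (f a))⁻¹ • f a))
    have hq : ∀ x, q x = x - (l x * (l (f a))⁻¹) • f a := fun x => by simp [q, smul_smul]
    rcases ih (fun i => q (f i)) (q u) with ⟨c, hc, hcu⟩ | ⟨m, hm, hmu⟩
    · left
      have h1 : 0 ≤ l u * (l (f a))⁻¹ :=
        mul_nonneg_of_nonpos_of_nonpos hlu.le (inv_nonpos.2 hla.le)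
      have h2 : 0 ≤ -∑ i ∈ s, c i * (l (f i) * (l (f a))⁻¹) := by
        rw [neg_nonneg]
        exact Finset.sum_nonpos fun i hi => mul_nonpos_of_nonneg_of_nonpos (hc i)
          (mul_nonpos_of_nonneg_of_nonpos (hl i hi) (inv_nonpos.2 hla.le))
      refine ⟨Function.update c a (l u * (l (f a))⁻¹ +
        -∑ i ∈ s, c i * (l (f i) * (l (f a))⁻¹)), fun i => ?_, ?_⟩
      · rcases eq_or_ne i a with rfl | h
        · simpa using add_nonneg h1 h2
        · simpa [h] using hc i
      · have hcongr : ∀ x : ℝ, ∑ i ∈ s, Function.update c a x i • f i = ∑ i ∈ s, c i • f i :=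
          fun x => Finset.sum_congr rfl fun i hi => by
            rw [Function.update_of_ne (ne_of_mem_of_not_mem hi has)]
        rw [Finset.sum_insert has, Function.update_self, hcongr]
        simp only [hq, smul_sub, Finset.sum_sub_distrib, smul_smul, ← Finset.sum_smul] at hcu
        rw [sub_eq_iff_eq_add] at hcu
        rw [hcu]
        module
    · refine Or.inr ⟨m.comp q, fun i hi => ?_, hmu⟩
      rcases Finset.mem_insert.1 hi with rfl | hi
      · simp [hq, hla.ne]
      · exact hm i hi

end Farkas

/-! ### Elements of `Hom_c` of a dual cone -/

section HomC

variable {M N : Type*} [AddCommGroup M] [Module ℝ M] [AddCommGroup N] [Module ℝ N]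

lemma mem_dualCone {p : M →ₗ[ℝ] N →ₗ[ℝ] ℝ} {σ : PointedCone ℝ N} {u : M} :
    u ∈ dualCone p σ ↔ ∀ v ∈ σ, 0 ≤ p u v := Iff.rfl

/-- Every point of the dual of a finitely generated cone spans a ray inside the relative interior
of a single face: the face cut out by the sum of those generators on which the point vanishes. -/
lemma exists_face_smul_mem_relInt (p : M →ₗ[ℝ] N →ₗ[ℝ] ℝ) {σ : PointedCone ℝ N} (hσ : σ.FG)
    {u : M} (hu : u ∈ dualCone p σ) :
    ∃ F : PointedCone ℝ M, IsFace F (dualCone p σ) ∧ ∀ c : ℝ, 0 < c → c • u ∈ relInt F := by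
  classical
  obtain ⟨W, rfl⟩ := hσ
  set C := dualCone p (Submodule.span _ (W : Set N)) with hC
  have hmem : ∀ x, x ∈ C ↔ ∀ w ∈ W, 0 ≤ p x w := by
    intro x
    change x ∈ PointedCone.dual p.flip (PointedCone.hull ℝ (W : Set N) : Set N) ↔ _
    rw [PointedCone.dual_hull]
    rfl
  have hu' := (hmem u).1 hu
  let l : Module.Dual ℝ M := ∑ w ∈ W with p u w = 0, p.flip w
  have hlx : ∀ x, l x = ∑ w ∈ W with p u w = 0, p x w := fun x => by simp [l]
  have hl0 : ∀ x ∈ C, 0 ≤ l x := fun x hx => by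
    rw [hlx]
    exact Finset.sum_nonneg fun w hw => (hmem x).1 hx w (Finset.mem_filter.1 hw).1
  let F : PointedCone ℝ M :=
    { carrier := {x | x ∈ C ∧ l x = 0}
      add_mem' := fun {x y} hx hy => ⟨C.add_mem hx.1 hy.1, by simp [hx.2, hy.2]⟩
      zero_mem' := ⟨C.zero_mem, by simp⟩
      smul_mem' := fun c x hx => ⟨Submodule.smul_mem C c hx.1, by
        change l ((c : ℝ) • x) = 0
        rw [map_smul, hx.2, smul_zero]⟩ }
  have hF : ∀ x, x ∈ F ↔ x ∈ C ∧ l x = 0 := fun x => Iff.rfl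
  have huF : u ∈ F := ⟨hu, by
    rw [hlx]; exact Finset.sum_eq_zero fun w hw => (Finset.mem_filter.1 hw).2⟩
  refine ⟨F, ⟨l, hl0, hF⟩, fun c hc => ⟨PointedCone.smul_mem _ hc.le huF, ?_⟩⟩
  rintro τ ⟨m, hm0, hm⟩ hcu
  have hmu : m u = 0 := by
    have := ((hm _).1 hcu).2
    rw [map_smul, smul_eq_mul] at this
    exact (mul_eq_zero.1 this).resolve_left hc.ne'
  ext x
  refine ⟨fun hx => ((hm x).1 hx).1, fun hx => (hm x).2 ⟨hx, le_antisymm ?_ (hm0 x hx)⟩⟩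
  -- `u` lies so deep in the face that `u - ε x` still belongs to it
  have hx' := (hmem x).1 hx.1
  have hzero : ∀ w ∈ W, p u w = 0 → p x w = 0 := by
    intro w hw huw
    have h1 := hx.2
    rw [hlx, Finset.sum_eq_zero_iff_of_nonneg fun w hw => hx' w (Finset.mem_filter.1 hw).1] at h1
    exact h1 w (Finset.mem_filter.2 ⟨hw, huw⟩)
  have hε : ∃ ε : ℝ, 0 < ε ∧ ∀ w ∈ W, ε * p x w ≤ p u w := by
    have hall : ∀ w ∈ W, ∀ᶠ ε in nhdsWithin (0 : ℝ) (Set.Ioi 0), ε * p x w ≤ p u w := by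
      intro w hw
      by_cases huw : p u w = 0
      · simp [huw, hzero w hw huw]
      · have hcont : Continuous fun ε : ℝ => ε * p x w := by fun_prop
        have h1 := (hcont.tendsto' 0 0 (by simp)).eventually_lt_const
          (lt_of_le_of_ne (hu' w hw) (Ne.symm huw))
        exact (h1.filter_mono nhdsWithin_le_nhds).mono fun ε h => h.le
    obtain ⟨ε, h1, h2⟩ := ((W.eventually_all.2 hall).and self_mem_nhdsWithin).exists
    exact ⟨ε, h2, h1⟩
  obtain ⟨ε, hε0, hε⟩ := hε
  have h1 : u - ε • x ∈ F := ⟨(hmem _).2 fun w hw => by simpa using hε w hw, by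
    simp [huF.2, hx.2]⟩
  have h2 := hm0 _ h1
  rw [map_sub, map_smul, hmu, smul_eq_mul] at h2
  nlinarith

variable [TopologicalSpace M]

section General

variable {p : M →ₗ[ℝ] N →ₗ[ℝ] ℝ} {σ : PointedCone ℝ N}

lemma HomC.map_nsmul (φ : V p σ) (n : ℕ) (u : dualCone p σ) : φ.1 (n • u) = φ.1 u ^ n := by
  induction n with
  | zero => simpa using φ.2.1
  | succ n ih => rw [succ_nsmul, φ.2.2.1, ih, pow_succ]

/-- Elements of `Hom_c(σ^∨, ℝ≥0)` are homogeneous: multiplicativity gives this for rational `c`,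
and continuity along the ray of `u` extends it to all `c`. -/
lemma HomC.map_smul [ContinuousSMul ℝ M] (hσ : σ.FG) (φ : V p σ) {c : ℝ} (hc : 0 ≤ c)
    {u u' : dualCone p σ} (hu : (u' : M) = c • (u : M)) : φ.1 u' = φ.1 u ^ c := by
  obtain ⟨F, hF, hray⟩ := exists_face_smul_mem_relInt p hσ u.2
  let r : ℝ → dualCone p σ := fun t =>
    ⟨max t 0 • (u : M), PointedCone.smul_mem _ (le_max_right t 0) u.2⟩
  have hr' : ∀ {t : ℝ}, 0 ≤ t → (r t : M) = t • (u : M) := fun ht => by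
    change max _ 0 • (u : M) = _
    rw [max_eq_left ht]
  have hr : Continuous r := Continuous.subtype_mk (by fun_prop) _
  have hur : u' = r c := Subtype.ext (by rw [hu, hr' hc])
  rcases hc.eq_or_lt with rfl | hc
  · have : u' = 0 := Subtype.ext (by rw [hu, zero_smul]; rfl)
    rw [this, φ.2.1, NNReal.rpow_zero]
  have h1 : ContinuousOn (fun t => φ.1 (r t)) (Set.Ioi 0) := by
    refine (φ.2.2.2 F hF).comp hr.continuousOn fun t ht => ?_
    have := hray t ht
    rwa [← hr' (le_of_lt ht)] at this
  have h2 : ContinuousOn (fun t : ℝ => φ.1 u ^ t) (Set.Ioi 0) := fun t ht =>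
    (NNReal.continuousAt_rpow (Or.inr ht)).comp_continuousWithinAt
      (f := fun t : ℝ => (φ.1 u, t)) (by fun_prop)
  have h3 : Set.EqOn (fun t => φ.1 (r t)) (fun t : ℝ => φ.1 u ^ t)
      (Set.Ioi 0 ∩ Set.range ((↑) : ℚ → ℝ)) := by
    rintro _ ⟨ht, q, rfl⟩
    have hq : 0 < q := by simpa using ht
    have hqe : (q.den : ℝ) * q = q.num.toNat := by
      have h : (q.num.toNat : ℤ) = q.num := Int.toNat_of_nonneg (Rat.num_nonneg.2 hq.le)
      have h' : (q.num.toNat : ℚ) = q.num := by exact_mod_cast h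
      have := Rat.den_mul_eq_num q
      rw [← h'] at this
      exact_mod_cast this
    have h4 : q.den • r q = q.num.toNat • u := by
      apply Subtype.ext
      rw [AddSubmonoidClass.coe_nsmul, AddSubmonoidClass.coe_nsmul, hr' (le_of_lt ht),
        ← Nat.cast_smul_eq_nsmul ℝ, smul_smul, hqe, Nat.cast_smul_eq_nsmul]
    have h5 : φ.1 (r q) ^ q.den = (φ.1 u ^ (q : ℝ)) ^ q.den := by
      rw [← HomC.map_nsmul, h4, HomC.map_nsmul, ← NNReal.rpow_natCast (φ.1 u ^ (q : ℝ)),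
        ← NNReal.rpow_mul, mul_comm, hqe, NNReal.rpow_natCast]
    exact (pow_left_inj₀ zero_le zero_le q.den_nz).1 h5
  rw [hur]
  exact h3.of_subset_closure h1 h2 Set.inter_subset_left
    ((Rat.denseRange_cast (𝕜 := ℝ)).open_subset_closure_inter isOpen_Ioi) hc

lemma HomC.map_sum_smul [ContinuousSMul ℝ M] (hσ : σ.FG) (φ : V p σ) {ι : Type*} (s : Finset ι)
    {c : ι → ℝ} (hc : ∀ i, 0 ≤ c i) (u : ι → dualCone p σ) {u' : dualCone p σ}
    (hu : (u' : M) = ∑ i ∈ s, c i • (u i : M)) : φ.1 u' = ∏ i ∈ s, φ.1 (u i) ^ c i := by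
  classical
  let w : ι → dualCone p σ := fun i => ⟨c i • (u i : M), PointedCone.smul_mem _ (hc i) (u i).2⟩
  have hw : u' = ∑ i ∈ s, w i := Subtype.ext (by rw [hu, AddSubmonoidClass.coe_finsetSum])
  rw [hw]
  clear hu hw
  induction s using Finset.induction_on with
  | empty => simpa using φ.2.1
  | insert a s has ih =>
    rw [Finset.sum_insert has, Finset.prod_insert has, φ.2.2.1, ih,
      HomC.map_smul hσ φ (hc a) (u := u a) (u' := w a) rfl]

end General

/-- The element of `V_σ` with `u ↦ exp (-u·w)` on the face `v^⊥ ∩ σ^∨` of `σ^∨`, and `u ↦ 0` off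
this face: the distinguished point of the face, translated by `w`. Here `v` lies in `σ`. -/
noncomputable def facePoint [IsTopologicalAddGroup M] [ContinuousSMul ℝ M] [T2Space M]
    [FiniteDimensional ℝ M] (p : M →ₗ[ℝ] N →ₗ[ℝ] ℝ) (σ : PointedCone ℝ N) (v w : N)
    (hv : v ∈ σ) : V p σ :=
  open Classical in
  ⟨fun u => if p u v = 0 then (Real.exp (-(p u w))).toNNReal else 0, by simp,
    fun x y => by
      have hx := mem_dualCone.1 x.2 v hv
      have hy := mem_dualCone.1 y.2 v hv
      have hxy : p ((x + y : dualCone p σ) : M) v = 0 ↔ p x v = 0 ∧ p y v = 0 := by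
        rw [Submodule.coe_add, map_add, LinearMap.add_apply, add_eq_zero_iff_of_nonneg hx hy]
      by_cases h1 : p x v = 0
      · by_cases h2 : p y v = 0
        · simp only [if_pos (hxy.2 ⟨h1, h2⟩), if_pos h1, if_pos h2]
          rw [← Real.toNNReal_mul (Real.exp_pos _).le, ← Real.exp_add]
          simp [add_comm]
        · simp only [if_neg (fun h => h2 (hxy.1 h).2), if_neg h2, mul_zero]
      · simp only [if_neg (fun h => h1 (hxy.1 h).1), if_neg h1, zero_mul],
    fun F hF => by
      -- `v` vanishes on all of `F` or nowhere on its relative interior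
      by_cases hex : ∃ x ∈ relInt F, p x v = 0
      · obtain ⟨x, hx, hxv⟩ := hex
        obtain ⟨l, -, hl⟩ := hF
        let G : PointedCone ℝ M :=
          { carrier := {y | y ∈ F ∧ p y v = 0}
            add_mem' := fun {y z} hy hz => ⟨F.add_mem hy.1 hz.1, by simp [hy.2, hz.2]⟩
            zero_mem' := ⟨F.zero_mem, by simp⟩
            smul_mem' := fun c y hy => ⟨Submodule.smul_mem F c hy.1, by
              change p ((c : ℝ) • y) v = 0
              rw [_root_.map_smul, LinearMap.smul_apply, hy.2, smul_zero]⟩ }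
        have hG : G = F := hx.2 G ⟨p.flip v, fun y hy => mem_dualCone.1 ((hl y).1 hy).1 v hv,
          fun y => Iff.rfl⟩ ⟨hx.1, hxv⟩
        have hcont : Continuous fun u : dualCone p σ =>
            (Real.exp (-(p u w))).toNNReal := by
          have h : Continuous (p.flip w) := LinearMap.continuous_of_finiteDimensional _
          exact continuous_real_toNNReal.comp
            (Real.continuous_exp.comp (h.comp continuous_subtype_val).neg)
        refine hcont.continuousOn.congr fun u hu => if_pos ?_
        have : (u : M) ∈ G := hG ▸ hu.1
        exact this.2
      · exact (continuousOn_const (c := (0 : ℝ≥0))).congr fun u hu =>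
          if_neg fun h => hex ⟨u, hu, h⟩⟩

end HomC


/-! ### The binomial equations of the affine irrational toric variety -/

section Toric

variable {M N : Type*} [AddCommGroup M] [Module ℝ M] [AddCommGroup N] [Module ℝ N]

/-- The binomial equations of `Y_A`: `∏ z_a ^ c_a = ∏ z_a ^ d_a` for all real exponents `c, d ≥ 0`
with `∑ c_a a = ∑ d_a a`. The convention `0 ^ 0 = 1` makes them meaningful on the boundary of the
orthant. -/
def IsToric (A : Finset M) (z : A → ℝ) : Prop :=
  ∀ c d : A → ℝ, (∀ a, 0 ≤ c a) → (∀ a, 0 ≤ d a) → ∑ a, c a • (a : M) = ∑ a, d a • (a : M) →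
    ∏ a, z a ^ c a = ∏ a, z a ^ d a

/-- The point `z` of the orthant is the limit of the torus elements `w + n v` as `n → ∞`: its
coordinates are `exp (-a·w)` on the face `v^⊥` of the cone over `A`, and `0` off this face. -/
def IsFaceExp (p : M →ₗ[ℝ] N →ₗ[ℝ] ℝ) (A : Finset M) (v w : N) (z : A → ℝ) : Prop :=
  ∀ a : A, 0 ≤ p a v ∧ (p a v = 0 → z a = Real.exp (-(p a w))) ∧ (p a v ≠ 0 → z a = 0)

lemma IsFaceExp.ne_zero_iff {p : M →ₗ[ℝ] N →ₗ[ℝ] ℝ} {A : Finset M} {v w : N} {z : A → ℝ}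
    (h : IsFaceExp p A v w z) (a : A) : z a ≠ 0 ↔ p a v = 0 := by
  refine ⟨fun hz => by_contra fun hv => hz ((h a).2.2 hv), fun hv => ?_⟩
  rw [(h a).2.1 hv]
  exact (Real.exp_pos _).ne'

/-- On the support of a solution of the binomial equations, `log z` satisfies every linear relation
that holds in `A`. -/
lemma IsToric.sum_mul_log {A : Finset M} {z : A → ℝ} (hz : IsToric A z) (hz0 : ∀ a, 0 ≤ z a)
    {k : A → ℝ} (hk : ∑ a, k a • (a : M) = 0) (hk0 : ∀ a, z a = 0 → k a = 0) :
    ∑ a, k a * Real.log (z a) = 0 := by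
  have hpos : ∀ a, 0 ≤ max (k a) 0 := fun a => le_max_right _ _
  have hneg : ∀ a, 0 ≤ max (-k a) 0 := fun a => le_max_right _ _
  have hsub : ∀ a, k a = max (k a) 0 - max (-k a) 0 := fun a => by
    rcases le_total 0 (k a) with h | h
    · rw [max_eq_left h, max_eq_right (neg_nonpos.2 h), sub_zero]
    · rw [max_eq_right h, max_eq_left (neg_nonneg.2 h), zero_sub, neg_neg]
  have hprod := hz (fun a => max (k a) 0) (fun a => max (-k a) 0) hpos hneg (by
    rw [← sub_eq_zero, ← Finset.sum_sub_distrib, ← hk]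
    exact Finset.sum_congr rfl fun a _ => by rw [← sub_smul, ← hsub])
  have hlog : ∀ e : A → ℝ, (∀ a, z a = 0 → e a = 0) →
      Real.log (∏ a, z a ^ e a) = ∑ a, e a * Real.log (z a) := by
    intro e he
    have hfac : ∀ a, z a ^ e a ≠ 0 ∧ Real.log (z a ^ e a) = e a * Real.log (z a) := by
      intro a
      rcases (hz0 a).eq_or_lt with h | h
      · simp [he a h.symm]
      · exact ⟨(Real.rpow_pos_of_pos h _).ne', Real.log_rpow h _⟩
    rw [Real.log_prod fun a _ => (hfac a).1]
    exact Finset.sum_congr rfl fun a _ => (hfac a).2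
  have h := congrArg Real.log hprod
  rw [hlog _ fun a ha => by simp [hk0 a ha], hlog _ fun a ha => by simp [hk0 a ha],
    ← sub_eq_zero, ← Finset.sum_sub_distrib] at h
  rw [← h]
  exact Finset.sum_congr rfl fun a _ => by rw [← sub_mul, ← hsub]

/-- The support of a solution of the binomial equations is a face of the cone over `A`: by Farkas'
lemma a point of `A` off the support is separated from it, as otherwise it would occur in a linear
relation whose other side is supported on the support. -/
lemma IsToric.exists_separating (p : M →ₗ[ℝ] N →ₗ[ℝ] ℝ) [p.IsPerfPair] {A : Finset M}
    {z : A → ℝ} (hz : IsToric A z) (hz0 : ∀ a, 0 ≤ z a) {b : A} (hb : z b = 0) :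
    ∃ v : N, (∀ a : A, 0 ≤ p a v) ∧ (∀ a : A, z a ≠ 0 → p a v = 0) ∧ 0 < p b v := by
  classical
  rcases farkas (Finset.univ : Finset (A ⊕ A))
    (Sum.elim (fun a => (a : M)) fun a => if z a = 0 then 0 else -(a : M)) (-(b : M))
    with ⟨c, hc, hsum⟩ | ⟨l, hl, hlb⟩
  · exfalso
    simp only [Fintype.sum_sum_type, Sum.elim_inl, Sum.elim_inr] at hsum
    have hrel := hz (fun a => c (Sum.inl a) + (Pi.single b 1 : A → ℝ) a)
      (fun a => if z a = 0 then 0 else c (Sum.inr a))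
      (fun a => add_nonneg (hc _) (by
        rcases eq_or_ne a b with rfl | h
        · simp
        · simp [h]))
      (fun a => by
        split_ifs
        · exact le_rfl
        · exact hc _) (by
        have h1 : ∑ a : A, (Pi.single b 1 : A → ℝ) a • (a : M) = b := by
          rw [Finset.sum_eq_single b] <;> simp +contextual
        have h2 : ∑ a, c (Sum.inr a) • (if z a = 0 then (0 : M) else -(a : M)) =
            -∑ a, (if z a = 0 then 0 else c (Sum.inr a)) • (a : M) := by
          rw [← Finset.sum_neg_distrib]
          exact Finset.sum_congr rfl fun a _ => by split_ifs <;> simp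
        simp only [add_smul, Finset.sum_add_distrib, h1]
        rw [h2] at hsum
        rw [← sub_eq_zero, ← sub_eq_zero.2 hsum]
        abel)
    rw [Finset.prod_eq_zero (Finset.mem_univ b) (by
      rw [hb, Real.zero_rpow]
      have := hc (Sum.inl b)
      simp only [Pi.single_eq_same]
      positivity)] at hrel
    refine Finset.prod_ne_zero_iff.2 (fun a _ => ?_) hrel.symm
    split_ifs with h
    · simp
    · exact fun h' => h (Real.rpow_eq_zero_iff_of_nonneg (hz0 a) |>.1 h').1
  · refine ⟨p.flip.toPerfPair.symm l, fun a => ?_, fun a ha => ?_, ?_⟩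
    · simpa using hl (Sum.inl a) (Finset.mem_univ _)
    · have h1 := hl (Sum.inl a) (Finset.mem_univ _)
      have h2 := hl (Sum.inr a) (Finset.mem_univ _)
      simp only [Sum.elim_inl, Sum.elim_inr, if_neg ha, map_neg] at h1 h2
      rw [LinearMap.apply_toPerfPair_flip]
      linarith
    · rw [LinearMap.apply_toPerfPair_flip]
      simpa using hlb

/-- Solutions of the binomial equations in the orthant are the translates of the distinguished
points of the faces of the cone over `A`. -/
lemma IsToric.exists_isFaceExp (p : M →ₗ[ℝ] N →ₗ[ℝ] ℝ) [p.IsPerfPair] {A : Finset M}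
    {z : A → ℝ} (hz : IsToric A z) (hz0 : ∀ a, 0 ≤ z a) : ∃ v w, IsFaceExp p A v w z := by
  classical
  have hex : ∀ b : A, ∃ v : N, (∀ a : A, 0 ≤ p a v) ∧ (∀ a : A, z a ≠ 0 → p a v = 0) ∧
      (z b = 0 → 0 < p b v) := by
    intro b
    by_cases hb : z b = 0
    · obtain ⟨v, h1, h2, h3⟩ := hz.exists_separating p hz0 hb
      exact ⟨v, h1, h2, fun _ => h3⟩
    · exact ⟨0, by simp, by simp, fun h => absurd h hb⟩
  choose v hv0 hv1 hv2 using hex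
  -- the linear form `log z` on the span of the support, extended to `M`
  let L : (A → ℝ) →ₗ[ℝ] M := Fintype.linearCombination ℝ fun a => if z a = 0 then 0 else (a : M)
  let lg : (A → ℝ) →ₗ[ℝ] ℝ := Fintype.linearCombination ℝ fun a => Real.log (z a)
  have hker : lg ∈ (LinearMap.ker L).dualAnnihilator := by
    rw [Submodule.mem_dualAnnihilator]
    intro k hk
    rw [LinearMap.mem_ker, Fintype.linearCombination_apply] at hk
    rw [Fintype.linearCombination_apply]
    have := hz.sum_mul_log hz0 (k := fun a => if z a = 0 then 0 else k a) (by
      rw [← hk]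
      exact Finset.sum_congr rfl fun a _ => by split_ifs <;> simp) (fun a ha => by simp [ha])
    rw [← this]
    refine Finset.sum_congr rfl fun a _ => ?_
    split_ifs with h
    · simp [h]
    · rfl
  rw [← LinearMap.range_dualMap_eq_dualAnnihilator_ker] at hker
  obtain ⟨g, hg⟩ := hker
  have hga : ∀ a : A, z a ≠ 0 → g a = Real.log (z a) := by
    intro a ha
    have := LinearMap.congr_fun hg (Pi.single a 1)
    simpa [L, lg, Fintype.linearCombination_apply_single, ha] using this
  refine ⟨∑ b, v b, -p.flip.toPerfPair.symm g, fun a => ?_⟩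
  have hsum : p a (∑ b, v b) = ∑ b, p a (v b) := map_sum _ _ _
  refine ⟨hsum ▸ Finset.sum_nonneg fun b _ => hv0 b a, fun h => ?_, fun h => by_contra fun h' => ?_⟩
  · have hza : z a ≠ 0 := fun h' => by
      rw [hsum, Finset.sum_eq_zero_iff_of_nonneg fun b _ => hv0 b a] at h
      exact (hv2 a h').ne' (h a (Finset.mem_univ _))
    rw [map_neg, neg_neg, LinearMap.apply_toPerfPair_flip, hga a hza,
      Real.exp_log ((hz0 a).lt_of_ne' hza)]
  · exact h (by rw [hsum]; exact Finset.sum_eq_zero fun b _ => hv1 b a h')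

section Closure

variable [TopologicalSpace N] [IsTopologicalAddGroup N] [ContinuousSMul ℝ N] [T2Space N]
  [FiniteDimensional ℝ N]

lemma IsFaceExp.mem_affineITV {p : M →ₗ[ℝ] N →ₗ[ℝ] ℝ} {A : Finset M} {v w : N} {z : A → ℝ}
    (h : IsFaceExp p A v w z) : z ∈ affineITV p A := by
  refine mem_closure_of_tendsto (b := Filter.atTop)
    (f := fun (n : ℕ) (a : A) =>
      (torusHom p A (Multiplicative.ofAdd (w + (n : ℝ) • v)) a : ℝ))
    (tendsto_pi_nhds.2 fun a => ?_) (Filter.Eventually.of_forall fun n => ⟨_, rfl⟩)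
  have hval : ∀ n : ℕ, (torusHom p A (Multiplicative.ofAdd (w + (n : ℝ) • v)) a : ℝ) =
      Real.exp (-(p a w + n * p a v)) := fun n => by
    change Real.exp (-(p a (w + (n : ℝ) • v))) = _
    simp
  simp only [hval]
  by_cases ha : p a v = 0
  · simp [ha, (h a).2.1 ha]
  · rw [(h a).2.2 ha]
    refine Real.tendsto_exp_neg_atTop_nhds_zero.comp ?_
    exact Filter.tendsto_atTop_add_const_left _ _
      (tendsto_natCast_atTop_atTop.atTop_mul_const ((h a).1.lt_of_ne' ha))

lemma isToric_of_mem_affineITV {p : M →ₗ[ℝ] N →ₗ[ℝ] ℝ} {A : Finset M} {z : A → ℝ}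
    (hz : z ∈ affineITV p A) : IsToric A z := by
  have hclosed : IsClosed {z : A → ℝ | IsToric A z} := by
    simp only [IsToric, Set.ofPred_forall]
    refine isClosed_iInter fun c => isClosed_iInter fun d => isClosed_iInter fun hc =>
      isClosed_iInter fun hd => isClosed_iInter fun _ => isClosed_eq ?_ ?_
    · exact continuous_finsetProd _ fun a _ => (continuous_apply a).rpow_const fun _ => Or.inr (hc a)
    · exact continuous_finsetProd _ fun a _ => (continuous_apply a).rpow_const fun _ => Or.inr (hd a)
  refine closure_minimal ?_ hclosed hz
  rintro _ ⟨t, rfl⟩ c d - - hcd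
  have hprod : ∀ e : A → ℝ, ∏ a, (torusHom p A t a : ℝ) ^ e a =
      Real.exp (-(p (∑ a, e a • (a : M)) t.toAdd)) := by
    intro e
    change ∏ a : A, Real.exp (-(p a t.toAdd)) ^ e a = _
    simp only [← Real.exp_mul, ← Real.exp_sum, map_sum, LinearMap.sum_apply,
      map_smul, LinearMap.smul_apply, smul_eq_mul, ← Finset.sum_neg_distrib]
    congr 1
    exact Finset.sum_congr rfl fun a _ => by ring
  change ∏ a, (torusHom p A t a : ℝ) ^ c a = ∏ a, (torusHom p A t a : ℝ) ^ d a
  rw [hprod, hprod, hcd]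

/-- In the simplex, `Z_A` is cut out by the binomial equations. -/
lemma mem_projITV_iff_isToric {p : M →ₗ[ℝ] N →ₗ[ℝ] ℝ} [p.IsPerfPair] {A : Finset M}
    {z : stdSimplex ℝ A} :
    z ∈ projITV p A ↔ IsToric A z.1 := by
  refine ⟨fun hz => isToric_of_mem_affineITV hz, fun hz => ?_⟩
  obtain ⟨v, w, hvw⟩ := hz.exists_isFaceExp p z.2.1
  exact hvw.mem_affineITV

end Closure

end Toric


/-! ### Affine charts in the simplex -/

section Charts

variable {M N : Type*} [AddCommGroup M] [Module ℝ M] [AddCommGroup N] [Module ℝ N]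

/-- The point `s ∈ A` lies on the face of `conv A` dual to `σ`: every `v ∈ σ` is minimal at `s`. -/
def IsBase (p : M →ₗ[ℝ] N →ₗ[ℝ] ℝ) (A : Finset M) (σ : PointedCone ℝ N) (s : A) : Prop :=
  ∀ a : A, (a : M) - s ∈ dualCone p σ

lemma IsBase.le {p : M →ₗ[ℝ] N →ₗ[ℝ] ℝ} {A : Finset M} {σ : PointedCone ℝ N} {s : A}
    (hs : IsBase p A σ s) {v : N} (hv : v ∈ σ) (a : A) : p s v ≤ p a v := by
  have := mem_dualCone.1 (hs a) v hv
  rwa [map_sub, LinearMap.sub_apply, sub_nonneg] at this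

lemma IsBase.anti {p : M →ₗ[ℝ] N →ₗ[ℝ] ℝ} {A : Finset M} {σ τ : PointedCone ℝ N} {s : A}
    (hs : IsBase p A σ s) (h : τ ≤ σ) : IsBase p A τ s :=
  fun a => mem_dualCone.2 fun v hv => mem_dualCone.1 (hs a) v (h hv)

section NormalCone

variable {p : M →ₗ[ℝ] N →ₗ[ℝ] ℝ} {A : Finset M} {σ : PointedCone ℝ N}

lemma isBase_of_mem_minimizers (hA : A.Nonempty) {v : N} {s : A} (hs : (s : M) ∈ minimizers p A v) :
    IsBase p A (normalCone p (convexHull ℝ (A : Set M))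
      (exposedFace p (convexHull ℝ (A : Set M)) v)) s := by
  refine fun a => mem_dualCone.2 fun w hw => ?_
  rw [mem_normalCone_minimizers p A hA] at hw
  simpa using (hw hs).2 a a.2

lemma exists_isBase (hA : A.Nonempty) (hσ : σ ∈ normalCones p (convexHull ℝ (A : Set M))) :
    ∃ s, IsBase p A σ s := by
  obtain ⟨v, rfl⟩ := hσ
  obtain ⟨s, hs, hmin⟩ := A.exists_min_image (fun s => p s v) hA
  exact ⟨⟨s, hs⟩, isBase_of_mem_minimizers hA ⟨hs, hmin⟩⟩

lemma mem_of_forall_isBase_le (hA : A.Nonempty)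
    (hσ : σ ∈ normalCones p (convexHull ℝ (A : Set M))) {w : N}
    (hw : ∀ s, IsBase p A σ s → ∀ a : A, p s w ≤ p a w) : w ∈ σ := by
  obtain ⟨v, rfl⟩ := hσ
  rw [mem_normalCone_minimizers p A hA]
  exact fun s hs => ⟨hs.1, fun a ha =>
    hw ⟨s, hs.1⟩ (isBase_of_mem_minimizers hA hs) ⟨a, ha⟩⟩

open Classical in
/-- A finite family that generates the dual cone of a normal cone `σ` of `conv A`: the differences
`a - s` with `s` on the face dual to `σ`, and zeros for the other pairs. -/
noncomputable def dualGen (p : M →ₗ[ℝ] N →ₗ[ℝ] ℝ) (A : Finset M) (σ : PointedCone ℝ N)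
    (i : A × A) : dualCone p σ :=
  if h : IsBase p A σ i.2 then ⟨i.1 - i.2, h i.1⟩ else 0

lemma exists_eq_sum_dualGen [p.IsPerfPair] (hA : A.Nonempty)
    (hσ : σ ∈ normalCones p (convexHull ℝ (A : Set M))) {u : M} (hu : u ∈ dualCone p σ) :
    ∃ c : A × A → ℝ, (∀ i, 0 ≤ c i) ∧ u = ∑ i, c i • (dualGen p A σ i : M) := by
  rcases farkas (Finset.univ : Finset (A × A)) (fun i => (dualGen p A σ i : M)) u with
    ⟨c, hc, h⟩ | ⟨l, hl, hlu⟩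
  · exact ⟨c, hc, h.symm⟩
  · refine absurd (mem_dualCone.1 hu (p.flip.toPerfPair.symm l)
      (mem_of_forall_isBase_le hA hσ fun s hs a => ?_)) (by simpa using hlu)
    have := hl (a, s) (Finset.mem_univ _)
    simpa [dualGen, hs] using this

end NormalCone

lemma stdSimplex_eq_of_proportional {ι : Type*} [Fintype ι] {z z' : stdSimplex ℝ ι} (c : ℝ)
    (h : ∀ i, z.1 i = c * z'.1 i) : z = z' := by
  have hc : c = 1 := by
    have h1 := z.2.2
    rw [Finset.sum_congr rfl fun i _ => h i, ← Finset.mul_sum, z'.2.2, mul_one] at h1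
    exact h1
  apply Subtype.ext
  funext i
  rw [h, hc, one_mul]

lemma IsFaceExp.apply_isBase {p : M →ₗ[ℝ] N →ₗ[ℝ] ℝ} {A : Finset M} {σ : PointedCone ℝ N}
    {s : A} {v w : N} {z : stdSimplex ℝ A} (hz : IsFaceExp p A v w z.1)
    (hv : v ∈ σ) (hs : IsBase p A σ s) : p s v = 0 := by
  obtain ⟨a, ha⟩ : ∃ a, z.1 a ≠ 0 := by
    by_contra! h
    have := z.2.2
    rw [Finset.sum_eq_zero fun a _ => h a] at this
    exact zero_ne_one this
  have := hs.le hv a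
  rw [(hz.ne_zero_iff a).1 ha] at this
  exact le_antisymm this (hz s).1

variable [TopologicalSpace M]

section Chart

variable {p : M →ₗ[ℝ] N →ₗ[ℝ] ℝ} {A : Finset M} {σ : PointedCone ℝ N} {s : A}

lemma sum_chart_pos (hs : IsBase p A σ s) (φ : V p σ) :
    0 < ∑ a : A, (φ.1 ⟨a - s, hs a⟩ : ℝ) := by
  refine Finset.sum_pos' (fun a _ => NNReal.coe_nonneg _) ⟨s, Finset.mem_univ _, ?_⟩
  have : (⟨s - s, hs s⟩ : dualCone p σ) = 0 := Subtype.ext (sub_self _)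
  rw [this, φ.2.1]
  simp

/-- The map `V_σ → Δ^A` whose homogeneous coordinates are `φ(a - s)`, `a ∈ A`, where `s` is a point
of `A` on the face dual to `σ`. -/
noncomputable def chart (hs : IsBase p A σ s) (φ : V p σ) : stdSimplex ℝ A :=
  ⟨fun a => (φ.1 ⟨a - s, hs a⟩ : ℝ) / ∑ b : A, (φ.1 ⟨b - s, hs b⟩ : ℝ),
    fun _ => div_nonneg (NNReal.coe_nonneg _) (sum_chart_pos hs φ).le, by
      rw [← Finset.sum_div, div_self (sum_chart_pos hs φ).ne']⟩

lemma continuous_chart (hs : IsBase p A σ s) : Continuous (chart hs) := by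
  have heval : ∀ u : dualCone p σ, Continuous fun φ : V p σ => (φ.1 u : ℝ) := fun u =>
    NNReal.continuous_coe.comp ((continuous_apply u).comp continuous_subtype_val)
  refine Continuous.subtype_mk (continuous_pi fun a => ?_) _
  exact (heval _).div (continuous_finsetSum _ fun b _ => heval _)
    fun φ => (sum_chart_pos hs φ).ne'

/-- The chart does not depend on the chosen point `s`: any other point `s'` of `A` on the same face
gives proportional coordinates. -/
lemma chart_eq_mul {s' : A} (hs : IsBase p A σ s) (hs' : IsBase p A σ s') (φ : V p σ) (a : A) :
    (chart hs φ).1 a = φ.1 ⟨a - s', hs' a⟩ * (chart hs φ).1 s' := by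
  have h : (⟨a - s, hs a⟩ : dualCone p σ) = ⟨a - s', hs' a⟩ + ⟨s' - s, hs s'⟩ :=
    Subtype.ext (by simp)
  change (φ.1 ⟨a - s, hs a⟩ : ℝ) / _ = _ * ((φ.1 ⟨s' - s, hs s'⟩ : ℝ) / _)
  rw [h, φ.2.2.1, NNReal.coe_mul, mul_div_assoc]

lemma chart_pos {s' : A} (hs : IsBase p A σ s) (hs' : IsBase p A σ s') (φ : V p σ) :
    0 < (chart hs φ).1 s' := by
  refine ((chart hs φ).2.1 s').lt_of_ne' fun h => ?_
  have h1 := (chart hs φ).2.2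
  rw [Finset.sum_eq_zero fun a _ => by rw [chart_eq_mul hs hs', h, mul_zero]] at h1
  exact zero_ne_one h1

lemma eq_chart (hs : IsBase p A σ s) (φ : V p σ) {z : stdSimplex ℝ A}
    (h : ∀ a, z.1 a = φ.1 ⟨a - s, hs a⟩ * z.1 s) : z = chart hs φ := by
  refine stdSimplex_eq_of_proportional (z.1 s * ∑ b : A, (φ.1 ⟨b - s, hs b⟩ : ℝ)) fun a => ?_
  change _ = _ * ((φ.1 ⟨a - s, hs a⟩ : ℝ) / _)
  rw [h a, mul_right_comm, mul_div_assoc', mul_comm (z.1 s), div_mul_cancel₀ _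
    (sum_chart_pos hs φ).ne']

lemma eval_dualGen_of_not (φ : V p σ) {i : A × A} (hi : ¬ IsBase p A σ i.2) :
    φ.1 (dualGen p A σ i) = 1 := by
  rw [dualGen, dif_neg hi, φ.2.1]

lemma coe_eval_dualGen (hs : IsBase p A σ s) (φ : V p σ) {i : A × A} (hi : IsBase p A σ i.2) :
    (φ.1 (dualGen p A σ i) : ℝ) = (chart hs φ).1 i.1 / (chart hs φ).1 i.2 := by
  rw [dualGen, dif_pos hi, eq_div_iff (chart_pos hs hi φ).ne', ← chart_eq_mul hs hi φ]

variable [ContinuousSMul ℝ M]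

/-- Points of the charts satisfy the binomial equations. The hyperplane hypothesis makes these
equations homogeneous, so that the normalization to coordinate sum one preserves them. -/
lemma isToric_chart (hσ : σ.FG) {v₀ : N} {r : ℝ} (hr : r ≠ 0) (hv₀ : ∀ a : A, p a v₀ = r)
    (hs : IsBase p A σ s) (φ : V p σ) : IsToric A (chart hs φ).1 := by
  intro c d hc hd hcd
  have hdeg : ∀ e : A → ℝ, p (∑ a, e a • (a : M)) v₀ = (∑ a, e a) * r := fun e => by
    simp [map_sum, LinearMap.sum_apply, hv₀, Finset.sum_mul]
  have hsum : ∑ a, c a = ∑ a, d a := by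
    have := hdeg c
    rw [hcd, hdeg] at this
    exact (mul_right_cancel₀ hr this).symm
  have hpos := chart_pos hs hs φ
  have hprod : ∀ e : A → ℝ, (∀ a, 0 ≤ e a) → ∀ u : dualCone p σ,
      (u : M) = ∑ a, e a • ((a : M) - s) →
      ∏ a, (chart hs φ).1 a ^ e a = φ.1 u * (chart hs φ).1 s ^ ∑ a, e a := by
    intro e he u hu
    rw [HomC.map_sum_smul hσ φ Finset.univ he (fun a => ⟨a - s, hs a⟩) hu,
      Real.rpow_sum_of_pos hpos, NNReal.coe_prod, ← Finset.prod_mul_distrib]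
    refine Finset.prod_congr rfl fun a _ => ?_
    rw [chart_eq_mul hs hs, Real.mul_rpow (NNReal.coe_nonneg _) hpos.le, NNReal.coe_rpow]
  have hu : ∑ a, d a • ((a : M) - s) ∈ dualCone p σ :=
    Submodule.sum_mem _ fun a _ => PointedCone.smul_mem _ (hd a) (hs a)
  rw [hprod c hc ⟨_, hu⟩ (by
      simp only [smul_sub, Finset.sum_sub_distrib, ← Finset.sum_smul, hcd, hsum]),
    hprod d hd ⟨_, hu⟩ rfl, hsum]

lemma eval_eq_prod_dualGen (hσ : σ.FG) (φ : V p σ) {c : A × A → ℝ} (hc : ∀ i, 0 ≤ c i)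
    {u : dualCone p σ} (hu : (u : M) = ∑ i, c i • (dualGen p A σ i : M)) :
    φ.1 u = ∏ i, φ.1 (dualGen p A σ i) ^ c i :=
  HomC.map_sum_smul hσ φ Finset.univ hc _ hu

variable [p.IsPerfPair]

lemma chart_injective (hA : A.Nonempty) (hσ : σ ∈ normalCones p (convexHull ℝ (A : Set M)))
    (hfg : σ.FG) (hs : IsBase p A σ s) : Function.Injective (chart hs) := by
  intro φ ψ h
  apply Subtype.ext
  funext u
  obtain ⟨c, hc, hu⟩ := exists_eq_sum_dualGen hA hσ u.2
  rw [eval_eq_prod_dualGen hfg φ hc hu, eval_eq_prod_dualGen hfg ψ hc hu]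
  refine Finset.prod_congr rfl fun i _ => congrArg (· ^ c i) ?_
  by_cases hi : IsBase p A σ i.2
  · ext
    rw [coe_eval_dualGen hs φ hi, coe_eval_dualGen hs ψ hi, h]
  · rw [eval_dualGen_of_not φ hi, eval_dualGen_of_not ψ hi]

/-- The chart of `V_σ` is inducing: evaluations at the generators of `σ^∨` are ratios of
coordinates, and all other evaluations are monomials in these. -/
lemma continuous_of_continuous_chart {X : Type*} [TopologicalSpace X] (hA : A.Nonempty)
    (hσ : σ ∈ normalCones p (convexHull ℝ (A : Set M))) (hfg : σ.FG) (hs : IsBase p A σ s)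
    {g : X → V p σ} (hg : Continuous fun x => chart hs (g x)) : Continuous g := by
  refine Continuous.subtype_mk (f := fun x => (g x).1) (continuous_pi fun u => ?_) fun x => (g x).2
  obtain ⟨c, hc, hu⟩ := exists_eq_sum_dualGen hA hσ u.2
  have heval : ∀ x, (g x).1 u = ∏ i, (g x).1 (dualGen p A σ i) ^ c i :=
    fun x => eval_eq_prod_dualGen hfg (g x) hc hu
  simp only [heval]
  refine continuous_finsetProd _ fun i _ =>
    (NNReal.continuous_rpow_const (hc i)).comp (g := fun y : ℝ≥0 => y ^ c i) ?_
  have hcoord : ∀ a, Continuous fun x => (chart hs (g x)).1 a := fun a =>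
    (continuous_apply a).comp (continuous_subtype_val.comp hg)
  by_cases hi : IsBase p A σ i.2
  · refine NNReal.isEmbedding_coe.continuous_iff.2 ?_
    simp only [Function.comp_def, coe_eval_dualGen hs _ hi]
    exact (hcoord _).div (hcoord _) fun x => (chart_pos hs hi (g x)).ne'
  · simp only [eval_dualGen_of_not _ hi]
    exact continuous_const

end Chart

section FacePoint

variable [IsTopologicalAddGroup M] [ContinuousSMul ℝ M] [T2Space M] [FiniteDimensional ℝ M]
  {p : M →ₗ[ℝ] N →ₗ[ℝ] ℝ} {A : Finset M} {σ : PointedCone ℝ N} {s : A}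

/-- The distinguished point of `V_σ` given by `v ∈ σ`, translated by `w`, has the coordinates
`exp (-a·w)` on the face `v^⊥`. -/
lemma chart_facePoint {v w : N} {z : stdSimplex ℝ A} (hz : IsFaceExp p A v w z.1)
    (hv : v ∈ σ) (hs : IsBase p A σ s) : chart hs (facePoint p σ v w hv) = z := by
  refine (eq_chart hs _ fun a => ?_).symm
  have hsv := hz.apply_isBase hv hs
  rw [(hz s).2.1 hsv]
  simp only [facePoint]
  by_cases ha : p a v = 0
  · rw [if_pos (by simp [ha, hsv]), (hz a).2.1 ha, Real.coe_toNNReal _ (Real.exp_pos _).le,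
      ← Real.exp_add]
    congr 1
    simp only [map_sub, LinearMap.sub_apply]
    ring
  · rw [if_neg (by simpa [hsv] using ha), (hz a).2.2 ha]
    simp

end FacePoint

end Charts

/-! ### The map from the toric variety to the simplex -/

section Global

variable {M N : Type*} [AddCommGroup M] [Module ℝ M] [TopologicalSpace M]
  [AddCommGroup N] [Module ℝ N] {p : M →ₗ[ℝ] N →ₗ[ℝ] ℝ} {A : Finset M} {S : Fan N}

lemma IsFace.le {E : Type*} [AddCommGroup E] [Module ℝ E] {τ σ : PointedCone ℝ E}
    (h : IsFace τ σ) : τ ≤ σ := by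
  obtain ⟨l, -, hl⟩ := h
  exact fun x hx => ((hl x).1 hx).1

/-- The map `Y_Σ → Δ^A` glued from the charts of the `V_σ`. -/
noncomputable def toSimplex (hb : ∀ σ ∈ S.cones, ∃ s, IsBase p A σ s) :
    ITV p S → stdSimplex ℝ A :=
  Quot.lift (fun x => chart (hb x.1 x.1.2).choose_spec x.2) (by
    rintro ⟨τ, φ⟩ ⟨σ, ψ⟩ ⟨hface, hr⟩
    have hs := (hb σ σ.2).choose_spec
    refine eq_chart hs ψ fun a => ?_
    have h : ψ.1 ⟨a - _, hs a⟩ = φ.1 ⟨a - _, hs.anti hface.le a⟩ := hr _ _ _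
    rw [h]
    exact chart_eq_mul _ (hs.anti hface.le) φ a)

lemma toSimplex_mk (hb : ∀ σ ∈ S.cones, ∃ s, IsBase p A σ s) {σ : S.cones} {s : A}
    (hs : IsBase p A σ s) (φ : V p (σ : PointedCone ℝ N)) :
    toSimplex hb (Quot.mk _ ⟨σ, φ⟩) = chart hs φ :=
  eq_chart hs φ fun a => chart_eq_mul (hb σ σ.2).choose_spec hs φ a

lemma continuous_toSimplex (hb : ∀ σ ∈ S.cones, ∃ s, IsBase p A σ s) :
    Continuous (toSimplex hb) :=
  continuous_quot_lift _ (continuous_sigma fun σ => continuous_chart (hb σ σ.2).choose_spec)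

lemma isToric_toSimplex [ContinuousSMul ℝ M] (hb : ∀ σ ∈ S.cones, ∃ s, IsBase p A σ s) {v₀ : N}
    {r : ℝ} (hr : r ≠ 0) (hv₀ : ∀ a : A, p a v₀ = r) (y : ITV p S) :
    IsToric A (toSimplex hb y).1 := by
  obtain ⟨σ, φ⟩ := y
  exact isToric_chart (S.polyhedral σ σ.2) hr hv₀ _ φ

variable [IsTopologicalAddGroup M] [ContinuousSMul ℝ M] [T2Space M] [FiniteDimensional ℝ M]

lemma toSimplex_smul [TopologicalSpace N] [IsTopologicalAddGroup N] [ContinuousSMul ℝ N]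
    [T2Space N] [FiniteDimensional ℝ N] (hb : ∀ σ ∈ S.cones, ∃ s, IsBase p A σ s)
    (t : Multiplicative N) (y : ITV p S) :
    toSimplex hb (t • y) = torusHom p A t • toSimplex hb y := by
  obtain ⟨σ, φ⟩ := y
  refine (eq_chart (hb σ σ.2).choose_spec (t • φ) fun a => ?_).symm
  set s := (hb σ σ.2).choose
  have hs : IsBase p A σ s := (hb σ σ.2).choose_spec
  have hchart := chart_eq_mul hs hs φ a
  set z := chart hs φ
  change Real.exp (-(p a t.toAdd)) * z.1 a / _ = (Real.exp (-(p ((a : M) - s) t.toAdd)) *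
    (φ.1 ⟨a - s, hs a⟩ : ℝ)) * (Real.exp (-(p s t.toAdd)) * z.1 s / _)
  have hexp : Real.exp (-(p a t.toAdd)) =
      Real.exp (-(p ((a : M) - s) t.toAdd)) * Real.exp (-(p s t.toAdd)) := by
    rw [← Real.exp_add]
    congr 1
    simp only [map_sub, LinearMap.sub_apply]
    ring
  rw [hchart, hexp]
  ring

/-- The point of `Y_Σ` in the chart of the cone of all `v'` that are minimal wherever `v` is: the
distinguished point given by `v`, translated by `w`. -/
noncomputable def faceClass
    (hS : S.cones = normalCones p (convexHull ℝ (A : Set M))) (hA : A.Nonempty)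
    (v w : N) : ITV p S :=
  Quot.mk _ ⟨⟨normalCone p (convexHull ℝ (A : Set M)) (exposedFace p (convexHull ℝ (A : Set M)) v),
    hS ▸ ⟨v, rfl⟩⟩, facePoint p _ v w ((mem_normalCone_minimizers p A hA v v).2 subset_rfl)⟩

lemma toSimplex_faceClass
    (hS : S.cones = normalCones p (convexHull ℝ (A : Set M))) (hA : A.Nonempty)
    (hb : ∀ σ ∈ S.cones, ∃ s, IsBase p A σ s)
    {v w : N} {z : stdSimplex ℝ A} (hz : IsFaceExp p A v w z.1) :
    toSimplex hb (faceClass hS hA v w) = z :=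
  chart_facePoint hz ((mem_normalCone_minimizers p A hA v v).2 subset_rfl) _

variable [p.IsPerfPair]

/-- A point of the chart of `σ` with face coordinates given by `v` and `w` already lies in the
smaller chart of the normal cone through `v`, and it is determined by `v` and `w`. -/
lemma eq_faceClass
    (hS : S.cones = normalCones p (convexHull ℝ (A : Set M))) (hA : A.Nonempty)
    (hb : ∀ σ ∈ S.cones, ∃ s, IsBase p A σ s)
    {v w : N} {y : ITV p S} (hy : IsFaceExp p A v w (toSimplex hb y).1) :
    y = faceClass hS hA v w := by
  obtain ⟨σ, φ⟩ := y
  have hσ : (σ : PointedCone ℝ N) ∈ normalCones p (convexHull ℝ (A : Set M)) := hS ▸ σ.2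
  obtain ⟨s, hs⟩ := hb σ σ.2
  replace hy : IsFaceExp p A v w (chart hs φ).1 := by
    rw [← toSimplex_mk hb hs φ]
    exact hy
  have hbase : ∀ s', IsBase p A σ s' → p s' v = 0 := fun s' hs' =>
    (hy.ne_zero_iff s').1 (chart_pos hs hs' φ).ne'
  have hv : v ∈ (σ : PointedCone ℝ N) := mem_of_forall_isBase_le hA hσ fun s' hs' a => by
    rw [hbase s' hs']
    exact (hy a).1
  have hφ : φ = facePoint p σ v w hv :=
    chart_injective hA hσ (S.polyhedral σ σ.2) hs (chart_facePoint hy hv hs).symm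
  have hle : normalCone p (convexHull ℝ (A : Set M))
      (exposedFace p (convexHull ℝ (A : Set M)) v) ≤ σ := fun w' hw' => by
    rw [mem_normalCone_minimizers p A hA] at hw'
    refine mem_of_forall_isBase_le hA hσ fun s' hs' a => (hw' ⟨s'.2, fun b hb' => ?_⟩).2 a a.2
    rw [hbase s' hs']
    exact (hy ⟨b, hb'⟩).1
  refine (Quot.sound ⟨?_, fun u hu hu' => ?_⟩).symm
  · have := (S.inter_isFace σ σ.2 _ (hS ▸ ⟨v, rfl⟩ : normalCone p (convexHull ℝ (A : Set M))
      (exposedFace p (convexHull ℝ (A : Set M)) v) ∈ S.cones)).1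
    rwa [inf_eq_right.2 hle] at this
  · rw [hφ]
    rfl

lemma toSimplex_injective
    (hS : S.cones = normalCones p (convexHull ℝ (A : Set M))) (hA : A.Nonempty)
    (hb : ∀ σ ∈ S.cones, ∃ s, IsBase p A σ s)
    {v₀ : N} {r : ℝ} (hr : r ≠ 0) (hv₀ : ∀ a : A, p a v₀ = r) :
    Function.Injective (toSimplex hb) := by
  intro y y' h
  obtain ⟨v, w, hvw⟩ := (isToric_toSimplex hb hr hv₀ y).exists_isFaceExp p (toSimplex hb y).2.1
  exact (eq_faceClass hS hA hb hvw).trans (eq_faceClass hS hA hb (h ▸ hvw)).symm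

variable [TopologicalSpace N] [IsTopologicalAddGroup N] [ContinuousSMul ℝ N] [T2Space N]
  [FiniteDimensional ℝ N]

lemma range_toSimplex
    (hS : S.cones = normalCones p (convexHull ℝ (A : Set M))) (hA : A.Nonempty)
    (hb : ∀ σ ∈ S.cones, ∃ s, IsBase p A σ s)
    {v₀ : N} {r : ℝ} (hr : r ≠ 0) (hv₀ : ∀ a : A, p a v₀ = r) :
    Set.range (toSimplex hb) = projITV p A := by
  ext z
  rw [mem_projITV_iff_isToric]
  constructor
  · rintro ⟨y, rfl⟩
    exact isToric_toSimplex hb hr hv₀ y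
  · intro hz
    obtain ⟨v, w, hvw⟩ := hz.exists_isFaceExp p z.2.1
    exact ⟨faceClass hS hA v w, toSimplex_faceClass hS hA hb hvw⟩

/-- `Y_Σ` is compact, as the image of the compact set `Z_A` under the inverse of `toSimplex`. This
inverse is continuous, as it factors through `V_σ` on the open set where the coordinates at the
points of `A` on the face dual to `σ` do not vanish. -/
lemma compactSpace_itv
    (hS : S.cones = normalCones p (convexHull ℝ (A : Set M))) (hA : A.Nonempty)
    (hb : ∀ σ ∈ S.cones, ∃ s, IsBase p A σ s)
    {v₀ : N} {r : ℝ} (hr : r ≠ 0) (hv₀ : ∀ a : A, p a v₀ = r) :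
    CompactSpace (ITV p S) := by
  have hrange := range_toSimplex hS hA hb hr hv₀
  have hinj := toSimplex_injective hS hA hb hr hv₀
  have hex : ∀ z : projITV p A, ∃ y, toSimplex hb y = z.1 := fun z =>
    hrange.symm.subset z.2
  choose G hG using hex
  have hclosed : IsClosed (projITV p A) := isClosed_closure.preimage continuous_subtype_val
  have hcomp : CompactSpace (projITV p A) := isCompact_iff_compactSpace.1 hclosed.isCompact
  have hcont : Continuous G := by
    rw [continuous_iff_continuousAt]
    intro z
    obtain ⟨⟨σ, φ⟩, hy⟩ : ∃ x, Quot.mk _ x = G z := Quot.exists_rep _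
    have hσ : (σ : PointedCone ℝ N) ∈ normalCones p (convexHull ℝ (A : Set M)) := hS ▸ σ.2
    obtain ⟨s, hs⟩ := hb σ σ.2
    have hz : z.1 = chart hs φ := by rw [← hG z, ← hy, toSimplex_mk hb hs]
    let U : Set (projITV p A) := {z' | ∀ s', IsBase p A σ s' → 0 < z'.1.1 s'}
    have hUo : IsOpen U := by
      have : U = ⋂ s', ⋂ _ : IsBase p A σ s', {z' : projITV p A | 0 < z'.1.1 s'} := by
        ext; simp [U]
      rw [this]
      exact isOpen_iInter_of_finite fun s' => isOpen_iInter_of_finite fun _ =>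
        isOpen_lt continuous_const ((continuous_apply s').comp
          (continuous_subtype_val.comp continuous_subtype_val))
    have hzU : z ∈ U := fun s' hs' => by
      rw [hz]
      exact chart_pos hs hs' φ
    have hsec : ∀ z' : U, ∃ ψ : V p (σ : PointedCone ℝ N), chart hs ψ = z'.1.1 := by
      rintro ⟨z', hz'⟩
      obtain ⟨v, w, hvw⟩ := (mem_projITV_iff_isToric.1 z'.2).exists_isFaceExp p z'.1.2.1
      have hv : v ∈ (σ : PointedCone ℝ N) := mem_of_forall_isBase_le hA hσ fun s' hs' a => by
        rw [(hvw.ne_zero_iff s').1 (hz' s' hs').ne']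
        exact (hvw a).1
      exact ⟨facePoint p σ v w hv, chart_facePoint hvw hv hs⟩
    choose g hg using hsec
    have hgc : Continuous g := continuous_of_continuous_chart hA hσ (S.polyhedral σ σ.2) hs (by
      simp only [hg]
      exact continuous_subtype_val.comp continuous_subtype_val)
    have hGg : ∀ z' : U, G z' = Quot.mk _ ⟨σ, g z'⟩ := fun z' => hinj (by
      rw [hG, toSimplex_mk hb hs, hg])
    have hon : ContinuousOn G U := by
      rw [continuousOn_iff_continuous_domRestrict]
      have : U.domRestrict G = fun z' => Quot.mk _ ⟨σ, g z'⟩ := funext hGg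
      rw [this]
      exact continuous_quot_mk.comp (continuous_sigmaMk.comp hgc)
    exact hon.continuousAt (hUo.mem_nhds hzU)
  have hsurj : Function.Surjective G := fun y =>
    ⟨⟨toSimplex hb y, hrange.subset ⟨y, rfl⟩⟩, hinj (hG _)⟩
  exact hsurj.compactSpace hcont

end Global

/-! ### The moment map -/

section Moment

variable {M : Type*} [AddCommGroup M] [Module ℝ M] {A : Finset M}

/-- A solution of the binomial equations is determined by its moment. If `π z = π z'`, then the
equations with exponents `z` and `z'` show that the supports of `z` and `z'` agree and that
`∑ (z - z') (log z - log z') = 0`, where no summand is negative. -/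
lemma IsToric.eq_of_momentMap_eq {z z' : stdSimplex ℝ A} (hz : IsToric A z.1)
    (hz' : IsToric A z'.1) (h : momentMap A z = momentMap A z') : z = z' := by
  have hsupp : ∀ {x y : stdSimplex ℝ A}, IsToric A x.1 → momentMap A x = momentMap A y →
      ∀ a, x.1 a = 0 → y.1 a = 0 := by
    intro x y hx hxy a ha
    by_contra hne
    have h1 := hx x.1 y.1 x.2.1 y.2.1 hxy
    rw [Finset.prod_eq_zero (f := fun a => x.1 a ^ y.1 a) (Finset.mem_univ a) (by
      rw [ha, Real.zero_rpow hne])] at h1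
    obtain ⟨b, -, hb⟩ := Finset.prod_eq_zero_iff.1 h1
    obtain ⟨hb1, hb2⟩ := (Real.rpow_eq_zero_iff_of_nonneg (x.2.1 b)).1 hb
    exact hb2 hb1
  have hk : ∑ a, (z.1 a - z'.1 a) • (a : M) = 0 := by
    simp only [sub_smul, Finset.sum_sub_distrib]
    exact sub_eq_zero.2 h
  have h1 := hz.sum_mul_log z.2.1 hk fun a ha => by rw [ha, hsupp hz h a ha, sub_zero]
  have h2 := hz'.sum_mul_log z'.2.1 hk fun a ha => by rw [ha, hsupp hz' h.symm a ha, sub_zero]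
  have hterm : ∀ a, 0 ≤ (z.1 a - z'.1 a) * (Real.log (z.1 a) - Real.log (z'.1 a)) ∧
      ((z.1 a - z'.1 a) * (Real.log (z.1 a) - Real.log (z'.1 a)) = 0 → z.1 a = z'.1 a) := by
    intro a
    rcases (z.2.1 a).eq_or_lt with h0 | h0
    · simp [← h0, hsupp hz h a h0.symm]
    rcases (z'.2.1 a).eq_or_lt with h0' | h0'
    · simp [← h0', hsupp hz' h.symm a h0'.symm]
    rcases lt_trichotomy (z.1 a) (z'.1 a) with hlt | heq | hlt
    · have := mul_pos_of_neg_of_neg (sub_neg.2 hlt) (sub_neg.2 (Real.log_lt_log h0 hlt))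
      exact ⟨this.le, fun h => absurd h this.ne'⟩
    · simp [heq]
    · have := mul_pos (sub_pos.2 hlt) (sub_pos.2 (Real.log_lt_log h0' hlt))
      exact ⟨this.le, fun h => absurd h this.ne'⟩
  have hsum : ∑ a, (z.1 a - z'.1 a) * (Real.log (z.1 a) - Real.log (z'.1 a)) = 0 := by
    simp only [mul_sub (_ - _), Finset.sum_sub_distrib]
    rw [h1, h2, sub_zero]
  rw [Finset.sum_eq_zero_iff_of_nonneg fun a _ => (hterm a).1] at hsum
  exact Subtype.ext (funext fun a => (hterm a).2 (hsum a (Finset.mem_univ a)))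

/-- The tangent line inequality for the convex function `x ↦ x log x`, including the endpoint
`x = 0`. -/
lemma mul_log_sub_mul_log_le {x y : ℝ} (hx : 0 ≤ x) (hy : 0 < y) :
    y * Real.log y - x * Real.log x ≤ (y - x) * (1 + Real.log y) := by
  rcases hx.eq_or_lt with rfl | hx
  · simp only [zero_mul, sub_zero]
    nlinarith
  · have h := Real.log_le_sub_one_of_pos (div_pos hy hx)
    rw [Real.log_div hy.ne' hx.ne'] at h
    have h' := mul_le_mul_of_nonneg_left h hx.le
    rw [mul_sub x (y / x), mul_div_cancel₀ _ hx.ne'] at h'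
    nlinarith

/-- First variation of the entropy at a maximizer `z` over a fibre of the moment map, in a direction
`k` that points into the orthant: at a nearby point of the fibre, the derivative of `∑ z log z`
along `k` is still nonnegative. -/
lemma sum_mul_log_nonneg_of_isMinOn {z : stdSimplex ℝ A}
    (hz : ∀ z' : stdSimplex ℝ A, momentMap A z' = momentMap A z →
      ∑ a, z.1 a * Real.log (z.1 a) ≤ ∑ a, z'.1 a * Real.log (z'.1 a))
    {k : A → ℝ} (hk : ∑ a, k a • (a : M) = 0) (hk' : ∑ a, k a = 0) {ε : ℝ} (hε : 0 < ε)
    (hpos : ∀ a, z.1 a + ε * k a = 0 ∧ k a = 0 ∨ 0 < z.1 a + ε * k a) :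
    0 ≤ ∑ a, k a * Real.log (z.1 a + ε * k a) := by
  let z' : stdSimplex ℝ A := ⟨fun a => z.1 a + ε * k a,
    fun a => (hpos a).elim (fun h => h.1.ge) le_of_lt, by
      rw [Finset.sum_add_distrib, ← Finset.mul_sum, hk', z.2.2, mul_zero, add_zero]⟩
  have hmom : momentMap A z' = momentMap A z := by
    change ∑ a : A, (z.1 a + ε * k a) • (a : M) = ∑ a : A, z.1 a • (a : M)
    simp only [add_smul, mul_smul, Finset.sum_add_distrib, ← Finset.smul_sum, hk, smul_zero,
      add_zero]
  have h1 : ∑ a, ((z.1 a + ε * k a) * Real.log (z.1 a + ε * k a) - z.1 a * Real.log (z.1 a)) ≤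
      ∑ a, ε * k a * (1 + Real.log (z.1 a + ε * k a)) := by
    refine Finset.sum_le_sum fun a _ => ?_
    rcases hpos a with ⟨h1, h2⟩ | h
    · have : z.1 a = 0 := by simpa [h2] using h1
      simp [h2, this]
    · simpa using mul_log_sub_mul_log_le (z.2.1 a) h
  rw [Finset.sum_sub_distrib] at h1
  have h2 : ∑ a, ε * k a * (1 + Real.log (z.1 a + ε * k a)) =
      ε * ∑ a, k a * Real.log (z.1 a + ε * k a) := by
    simp only [mul_add, mul_one, Finset.sum_add_distrib, ← Finset.mul_sum, hk', mul_assoc]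
    rw [mul_zero, zero_add]
  have h3 := hz z' hmom
  rw [h2] at h1
  exact nonneg_of_mul_nonneg_right ((sub_nonneg.2 h3).trans h1) hε

/-- A maximizer of the entropy over a fibre of the moment map satisfies the binomial equations.
Leaving a face of the simplex would increase the entropy at an infinite rate, and within the face
the derivative of the entropy vanishes. -/
lemma isToric_of_isMinOn (hhom : ∀ k : A → ℝ, ∑ a, k a • (a : M) = 0 → ∑ a, k a = 0)
    {z : stdSimplex ℝ A}
    (hz : ∀ z' : stdSimplex ℝ A, momentMap A z' = momentMap A z →
      ∑ a, z.1 a * Real.log (z.1 a) ≤ ∑ a, z'.1 a * Real.log (z'.1 a)) : IsToric A z.1 := by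
  classical
  have hev : ∀ k : A → ℝ, (∀ a, z.1 a = 0 → 0 ≤ k a) → ∀ᶠ ε in nhdsWithin (0 : ℝ) (Set.Ioi 0),
      ∀ a, z.1 a + ε * k a = 0 ∧ k a = 0 ∨ 0 < z.1 a + ε * k a := by
    intro k hk
    rw [Filter.eventually_all]
    intro a
    rcases (z.2.1 a).eq_or_lt with h | h
    · rcases (hk a h.symm).eq_or_lt with h' | h'
      · simp [← h, ← h']
      · filter_upwards [self_mem_nhdsWithin] with ε hε
        rw [← h, zero_add]
        exact Or.inr (mul_pos hε h')
    · have hcont : Continuous fun ε : ℝ => z.1 a + ε * k a := by fun_prop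
      have := (hcont.tendsto' 0 (z.1 a) (by simp)).eventually_const_lt h
      exact (this.filter_mono nhdsWithin_le_nhds).mono fun ε h => Or.inr h
  have hlim : ∀ k : A → ℝ, ∀ a, z.1 a ≠ 0 ∨ k a = 0 →
      Filter.Tendsto (fun ε : ℝ => k a * Real.log (z.1 a + ε * k a)) (nhdsWithin 0 (Set.Ioi 0))
        (nhds (k a * Real.log (z.1 a))) := by
    rintro k a (h | h)
    · have hcont : Continuous fun ε : ℝ => z.1 a + ε * k a := by fun_prop
      have := (hcont.tendsto' 0 (z.1 a) (by simp)).log h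
      exact (this.const_mul _).mono_left nhdsWithin_le_nhds
    · simp [h]
  -- directions into the orthant stay in the face of the simplex that contains `z`
  have hface : ∀ k : A → ℝ, ∑ a, k a • (a : M) = 0 → (∀ a, z.1 a = 0 → 0 ≤ k a) →
      ∀ a, z.1 a = 0 → k a = 0 := by
    intro k hk hk0
    by_contra! hcon
    obtain ⟨b, hb, hkb⟩ := hcon
    have hkb' : 0 < k b := (hk0 b hb).lt_of_ne' hkb
    have hbot : Filter.Tendsto (fun ε : ℝ => ∑ a, k a * Real.log (z.1 a + ε * k a))
        (nhdsWithin 0 (Set.Ioi 0)) Filter.atBot := by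
      have hdiv : ∀ a, 0 < k a → z.1 a = 0 →
          Filter.Tendsto (fun ε : ℝ => k a * Real.log (z.1 a + ε * k a))
            (nhdsWithin 0 (Set.Ioi 0)) Filter.atBot := by
        intro a ha hza
        refine Filter.Tendsto.const_mul_atBot ha (Real.tendsto_log_nhdsGT_zero.comp ?_)
        refine tendsto_nhdsWithin_iff.2 ⟨?_, ?_⟩
        · have hcont : Continuous fun ε : ℝ => z.1 a + ε * k a := by fun_prop
          exact (hcont.tendsto' 0 0 (by simp [hza])).mono_left nhdsWithin_le_nhds
        · filter_upwards [self_mem_nhdsWithin] with ε hε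
          rw [hza, zero_add]
          exact mul_pos hε ha
      have hbdd : ∀ a, ∃ C : ℝ, ∀ᶠ ε in nhdsWithin (0 : ℝ) (Set.Ioi 0),
          k a * Real.log (z.1 a + ε * k a) ≤ C := by
        intro a
        by_cases ha : z.1 a ≠ 0 ∨ k a = 0
        · exact ⟨_, (hlim k a ha).eventually_le_const (lt_add_one _)⟩
        · push Not at ha
          exact ⟨0, (hdiv a ((hk0 a ha.1).lt_of_ne' ha.2) ha.1).eventually_le_atBot 0⟩
      choose C hC using hbdd
      refine Filter.tendsto_atBot_mono' _ ?_ (Filter.tendsto_atBot_add_const_right _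
        (∑ a ∈ Finset.univ.erase b, C a) (hdiv b hkb' hb))
      filter_upwards [Filter.eventually_all.2 hC] with ε hε
      rw [← Finset.add_sum_erase _ _ (Finset.mem_univ b)]
      gcongr with a
      exact hε a
    have h1 := (hev k hk0).and (self_mem_nhdsWithin (a := (0 : ℝ)) (s := Set.Ioi 0))
    obtain ⟨ε, ⟨h2, h3⟩, h4⟩ := (h1.and (hbot.eventually_lt_atBot 0)).exists
    exact absurd (sum_mul_log_nonneg_of_isMinOn hz hk (hhom k hk) h3 h2) (not_le.2 h4)
  have hle : ∀ k : A → ℝ, ∑ a, k a • (a : M) = 0 → (∀ a, z.1 a = 0 → k a = 0) →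
      0 ≤ ∑ a, k a * Real.log (z.1 a) := by
    intro k hk hk0
    have hlim' := tendsto_finsetSum Finset.univ fun a _ =>
      hlim k a (or_iff_not_imp_left.2 fun h => hk0 a (not_not.1 h))
    refine ge_of_tendsto hlim' ?_
    filter_upwards [hev k fun a ha => (hk0 a ha).ge, self_mem_nhdsWithin] with ε h1 h2
    exact sum_mul_log_nonneg_of_isMinOn hz hk (hhom k hk) h2 h1
  have hzero : ∀ k : A → ℝ, ∑ a, k a • (a : M) = 0 → (∀ a, z.1 a = 0 → k a = 0) →
      ∑ a, k a * Real.log (z.1 a) = 0 := by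
    intro k hk hk0
    refine le_antisymm ?_ (hle k hk hk0)
    have := hle (fun a => -k a)
      (by simp only [neg_smul, Finset.sum_neg_distrib, hk, neg_zero]) fun a ha => by simp [hk0 a ha]
    simpa using this
  intro c d hc hd hcd
  have hk : ∑ a, (c a - d a) • (a : M) = 0 := by
    simp only [sub_smul, Finset.sum_sub_distrib]
    exact sub_eq_zero.2 hcd
  have hk' : ∑ a, (d a - c a) • (a : M) = 0 := by
    simp only [sub_smul, Finset.sum_sub_distrib]
    exact sub_eq_zero.2 hcd.symm
  have hprod0 : ∀ e : A → ℝ, ∏ a, z.1 a ^ e a = 0 ↔ ∃ a, z.1 a = 0 ∧ e a ≠ 0 := by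
    intro e
    rw [Finset.prod_eq_zero_iff]
    simp [Real.rpow_eq_zero_iff_of_nonneg (z.2.1 _)]
  have himp : ∀ {e f : A → ℝ}, (∀ a, 0 ≤ e a) → ∑ a, (e a - f a) • (a : M) = 0 →
      (∃ a, z.1 a = 0 ∧ e a ≠ 0) → ∃ a, z.1 a = 0 ∧ f a ≠ 0 := by
    rintro e f he hef ⟨a, ha, hea⟩
    by_contra! hcon
    have := hface _ hef (fun a ha => by simpa [hcon a ha] using he a) a ha
    rw [hcon a ha, sub_zero] at this
    exact hea this
  by_cases hex : ∃ a, z.1 a = 0 ∧ c a ≠ 0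
  · rw [(hprod0 c).2 hex, (hprod0 d).2 (himp hc hk hex)]
  have hex' : ¬ ∃ a, z.1 a = 0 ∧ d a ≠ 0 := fun h => hex (himp hd hk' h)
  have hlog : ∀ e : A → ℝ, ¬ (∃ a, z.1 a = 0 ∧ e a ≠ 0) →
      ∏ a, z.1 a ^ e a = Real.exp (∑ a, e a * Real.log (z.1 a)) := by
    intro e he
    rw [Real.exp_sum]
    refine Finset.prod_congr rfl fun a _ => ?_
    rcases (z.2.1 a).eq_or_lt with h | h
    · have : e a = 0 := by_contra fun h' => he ⟨a, h.symm, h'⟩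
      simp [this]
    · rw [Real.rpow_def_of_pos h, mul_comm]
  push Not at hex hex'
  have := hzero _ hk fun a ha => by rw [hex a ha, hex' a ha, sub_zero]
  rw [hlog c (by push Not; exact hex), hlog d (by push Not; exact hex')]
  simp only [sub_mul, Finset.sum_sub_distrib] at this
  rw [sub_eq_zero.1 this]

lemma momentMap_mem_convexHull (z : stdSimplex ℝ A) :
    momentMap A z ∈ convexHull ℝ (A : Set M) :=
  (convex_convexHull ℝ _).sum_mem (fun a _ => z.2.1 a) z.2.2
    fun a _ => subset_convexHull ℝ _ a.2

variable [TopologicalSpace M] [IsTopologicalAddGroup M] [ContinuousSMul ℝ M]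

lemma continuous_momentMap : Continuous (momentMap A) := by
  refine continuous_finsetSum _ fun a _ => ?_
  exact ((continuous_apply a).comp continuous_subtype_val).smul continuous_const

/-- The moment map carries the solutions of the binomial equations onto `conv A`: the point of
maximal entropy in the fibre over `x` is a solution. -/
lemma exists_isToric_momentMap_eq [T2Space M]
    (hhom : ∀ k : A → ℝ, ∑ a, k a • (a : M) = 0 → ∑ a, k a = 0) {x : M}
    (hx : x ∈ convexHull ℝ (A : Set M)) :
    ∃ z : stdSimplex ℝ A, IsToric A z.1 ∧ momentMap A z = x := by
  have hne : {z : stdSimplex ℝ A | momentMap A z = x}.Nonempty := by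
    obtain ⟨c, hc0, hc1, hcx⟩ := (Finset.mem_convexHull' (R := ℝ)).1 hx
    refine ⟨⟨fun a => c a, fun a => hc0 a a.2, ?_⟩, ?_⟩
    · rw [← hc1]
      exact Finset.sum_coe_sort A c
    · rw [← hcx]
      exact Finset.sum_coe_sort A fun a => c a • a
  have hcomp : IsCompact {z : stdSimplex ℝ A | momentMap A z = x} :=
    (isClosed_eq continuous_momentMap continuous_const).isCompact
  have hcont : Continuous fun z : stdSimplex ℝ A => ∑ a, z.1 a * Real.log (z.1 a) :=
    continuous_finsetSum _ fun a _ =>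
      Real.continuous_mul_log.comp ((continuous_apply a).comp continuous_subtype_val)
  obtain ⟨z, hz, hmin⟩ := hcomp.exists_isMinOn hne hcont.continuousOn
  refine ⟨z, isToric_of_isMinOn hhom fun z' hz' => hmin (hz'.trans hz), hz⟩

end Moment

end IrrToric

theorem mainTheorem2 {M N : Type*}
    [AddCommGroup M] [Module ℝ M] [TopologicalSpace M] [IsTopologicalAddGroup M]
    [ContinuousSMul ℝ M] [T2Space M] [FiniteDimensional ℝ M]
    [AddCommGroup N] [Module ℝ N] [TopologicalSpace N] [IsTopologicalAddGroup N]
    [ContinuousSMul ℝ N] [T2Space N] [FiniteDimensional ℝ N]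
    (p : M →ₗ[ℝ] N →ₗ[ℝ] ℝ) [p.IsPerfPair]
    (P : Set M) (hP : IrrToric.IsPolytope P) (hne : P.Nonempty)
    (hyp : IrrToric.OnAffineHyperplane p P)
    (A : Finset M) (hA : (A : Set M) ⊆ P) (hconv : convexHull ℝ (A : Set M) = P) :
    ∃ Ψ : IrrToric.ITV p (IrrToric.normalFan p P hP hne) → stdSimplex ℝ A,
      Continuous Ψ ∧ Function.Injective Ψ ∧
      (∀ (t : Multiplicative N) (y : IrrToric.ITV p (IrrToric.normalFan p P hP hne)),
        Ψ (t • y) = IrrToric.torusHom p A t • Ψ y) ∧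
      Set.range Ψ = IrrToric.projITV p A ∧
      ∃ h : IrrToric.ITV p (IrrToric.normalFan p P hP hne) ≃ₜ P,
        ∀ y, (h y : M) = IrrToric.momentMap A (Ψ y) := by
  subst hconv
  obtain ⟨v₀, r, hr, hv⟩ := hyp
  have hv₀ : ∀ a : A, p a v₀ = r := fun a => hv a (hA a.2)
  have hAne : A.Nonempty := by simpa using hne
  have hS : (IrrToric.normalFan p (convexHull ℝ (A : Set M)) hP hne).cones =
      IrrToric.normalCones p (convexHull ℝ (A : Set M)) := rfl
  have hb : ∀ σ ∈ (IrrToric.normalFan p (convexHull ℝ (A : Set M)) hP hne).cones,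
      ∃ s, IrrToric.IsBase p A σ s := fun σ hσ => IrrToric.exists_isBase hAne hσ
  -- linear relations in `A` are homogeneous, since `A` lies on the hyperplane
  have hhom : ∀ k : A → ℝ, ∑ a, k a • (a : M) = 0 → ∑ a, k a = 0 := by
    intro k hk
    have h := congrArg (fun x => p x v₀) hk
    simp only [map_sum, LinearMap.sum_apply, map_smul, LinearMap.smul_apply, smul_eq_mul, hv₀,
      ← Finset.sum_mul, map_zero, LinearMap.zero_apply] at h
    exact (mul_eq_zero.1 h).resolve_right hr
  have hinj := IrrToric.toSimplex_injective hS hAne hb hr hv₀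
  have hrange := IrrToric.range_toSimplex hS hAne hb hr hv₀
  have hcomp := IrrToric.compactSpace_itv hS hAne hb hr hv₀
  have htoric := IrrToric.isToric_toSimplex hb hr hv₀
  refine ⟨IrrToric.toSimplex hb, IrrToric.continuous_toSimplex hb, hinj,
    IrrToric.toSimplex_smul hb, hrange, ?_⟩
  let f : IrrToric.ITV p (IrrToric.normalFan p (convexHull ℝ (A : Set M)) hP hne) →
      convexHull ℝ (A : Set M) :=
    fun y => ⟨IrrToric.momentMap A (IrrToric.toSimplex hb y), IrrToric.momentMap_mem_convexHull _⟩
  have hf : Continuous f := (IrrToric.continuous_momentMap.comp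
    (IrrToric.continuous_toSimplex hb)).subtype_mk _
  have hbij : Function.Bijective f := by
    refine ⟨fun y y' h => hinj ((htoric y).eq_of_momentMap_eq (htoric y')
      (congrArg Subtype.val h)), fun x => ?_⟩
    obtain ⟨z, hz, hzx⟩ := IrrToric.exists_isToric_momentMap_eq hhom x.2
    obtain ⟨y, rfl⟩ : z ∈ Set.range (IrrToric.toSimplex hb) :=
      hrange ▸ IrrToric.mem_projITV_iff_isToric.2 hz
    exact ⟨y, Subtype.ext hzx⟩
  exact ⟨Continuous.homeoOfEquivCompactToT2 (f := Equiv.ofBijective f hbij) hf, fun y => rfl⟩
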